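/- Let $d\geq 2$ be an integer, $p\in(1,+\infty]$, and write $\|\cdot\|_p$ for the $\ell_p$ norm on $\mathbb R^d$, $\Delta_d$ for the unit simplex of $\mathbb R^d$, $\odot$ for the componentwise product, $\log$ for the natural logarithm, and $2/p=1/p=0$ if $p=\infty$. At each stage $t\ge 1$ the Decision Maker chooses $a_t\in\Delta_d$ and the Environment chooses $\ell_t\in[0,1]^d$ (possibly depending on everything played before, including $a_t$). The average regret after $T$ stages is \[ \overline{\mathrm{Reg}}_T=\Big\|\frac1T\sum_{t=1}^T a_t\odot \ell_t\Big\|_p-\min_{a\in\Delta_d}\Big\|\frac1T\sum_{t=1}^T a\odot \ell_t\Big\|_p . \] On $(\mathbb R^d)^2$, with the pairing $\langle (y,y'),(z,z')\rangle=\sum_i y_iz_i+\sum_i y'_iz'_i$, put $r(a,\ell)=(a\odot\ell,\ell)$ and \[ \mathcal C=\Big\{(y,y')\in(\mathbb R_+^d)^2:\ \|y\|_p\le \min_{a\in\Delta_d}\|a\odot y'\|_p\Big\},\qquad \mathcal C^\circ=\{x:\ \langle w,x\rangle\le 0\ \ \forall w\in\mathcal C\}. \] Let $\mathcal B$ be the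 closed unit ball of the dual norm of $(y,y')\mapsto\|y\|_p+\max_{a\in\Delta_d}\|a\odot y'\|_p$, and let $\mathcal X=\mathcal B\cap\mathcal C^\circ$. Let \[ A=\min\{d^{1-2/p},1\},\qquad q'=1+(2\log d-1)^{-1},\qquad \eta_t=\frac{1}{2\sqrt{t\,\max\{d^{2/p-1},\,e(2\log d-1)\}}}\quad(t\ge1), \] and assume that $q'\in(1,2]$ (equivalently, $d\ge 3$). Let $h(z,z')=\frac A2\|z\|_2^2+\frac12\|z'\|_{q'}^2$ for $(z,z')\in\mathcal X$ and $h=+\infty$ elsewhere. Consider the algorithm which, at each stage $t\ge1$, computes (for $t=1$ the sum below is empty) \[ x_t=(z_t,z'_t)=\operatorname*{arg\,max}_{x\in\mathcal X}\Big\{\Big\langle \eta_{t-1}\sum_{s=1}^{t-1}r_s,\,x\Big\rangle-h(x)\Big\},\qquad a_t\in\operatorname*{arg\,min}_{a\in\Delta_d}\sum_{i=1}^d\max(0,\,z_{ti}a_i+z'_{ti}), \] plays $a_t$ and then observes $r_t=r(a_t,\ell_t)$. Then the algorithm is well defined (for every $w\in(\mathbb R^d)^2$ the function $x\mapsto\langle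 w,x\rangle-h(x)$ has a unique maximizer on $\mathcal X$, and for every $(z,z')\in(\mathbb R^d)^2$ the minimum defining the action is attained), and, whichever minimizers $a_t$ are used, it guarantees, against any sequence $(\ell_t)_{t\ge1}$ in $[0,1]^d$ chosen by the Environment, \[ \forall T\ge 1,\qquad \overline{\mathrm{Reg}}_T\le\frac{4}{\sqrt T}\max\Big\{d^{1/p-1/2},\ \sqrt{2e\log d}\Big\}. \] -/

import Mathlib

noncomputable section

namespace GlobalCost

/-- The `ℓ_p` norm on `ℝ^d`, for an extended exponent `p` (the sup norm when `p = ∞`). -/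
def lpNorm {d : ℕ} (p : ENNReal) (v : Fin d → ℝ) : ℝ := ‖WithLp.toLp p v‖

/-- Both the payoff space and its dual are `(ℝ^d)²`. -/
abbrev Pair (d : ℕ) : Type := (Fin d → ℝ) × (Fin d → ℝ)

/-- The duality pairing `⟨(y, y'), (z, z')⟩ = ∑ yᵢ zᵢ + ∑ y'ᵢ z'ᵢ`. -/
def pairing {d : ℕ} (w x : Pair d) : ℝ :=
  ∑ i, w.1 i * x.1 i + ∑ i, w.2 i * x.2 i

/-- The payoff `r(a, ℓ) = (a ⊙ ℓ, ℓ)`, where `⊙` is the componentwise product. -/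
def payoff {d : ℕ} (a ℓ : Fin d → ℝ) : Pair d := (a * ℓ, ℓ)

/-- The best static global cost `min_{a ∈ Δ_d} N (a ⊙ y)`
(the minimum of a continuous function over a nonempty compact set when `d ≥ 1`). -/
def minCost {d : ℕ} (N : (Fin d → ℝ) → ℝ) (y : Fin d → ℝ) : ℝ :=
  ⨅ a : stdSimplex ℝ (Fin d), N (a.1 * y)

/-- The worst static global cost `max_{a ∈ Δ_d} N (a ⊙ y)`. -/
def maxCost {d : ℕ} (N : (Fin d → ℝ) → ℝ) (y : Fin d → ℝ) : ℝ :=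
  ⨆ a : stdSimplex ℝ (Fin d), N (a.1 * y)

/-- The average regret after `T` stages, for actions `a 1, a 2, …` and losses `ℓ 1, ℓ 2, …`:
`N ((1/T) ∑ a_t ⊙ ℓ_t) - min_{b ∈ Δ_d} N ((1/T) ∑ b ⊙ ℓ_t)`. -/
def avgRegret {d : ℕ} (N : (Fin d → ℝ) → ℝ) (a ℓ : ℕ → Fin d → ℝ) (T : ℕ) : ℝ :=
  N ((T : ℝ)⁻¹ • ∑ t ∈ Finset.Icc 1 T, a t * ℓ t) -
    ⨅ b : stdSimplex ℝ (Fin d), N ((T : ℝ)⁻¹ • ∑ t ∈ Finset.Icc 1 T, b.1 * ℓ t)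

/-- The target cone `{(y, y') ∈ (ℝ_+^d)² : N y ≤ min_{a ∈ Δ_d} N (a ⊙ y')}`. -/
def targetCone {d : ℕ} (N : (Fin d → ℝ) → ℝ) : Set (Pair d) :=
  {w | 0 ≤ w.1 ∧ 0 ≤ w.2 ∧ N w.1 ≤ minCost N w.2}

/-- The polar cone of a set. -/
def polarCone {d : ℕ} (C : Set (Pair d)) : Set (Pair d) :=
  {x | ∀ w ∈ C, pairing w x ≤ 0}

/-- The norm `‖(y, y')‖ = N y + max_{a ∈ Δ_d} N (a ⊙ y')` on the payoff space. -/
def payoffNorm {d : ℕ} (N : (Fin d → ℝ) → ℝ) (w : Pair d) : ℝ :=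
  N w.1 + maxCost N w.2

/-- The dual norm of `payoffNorm N`. -/
def dualNorm {d : ℕ} (N : (Fin d → ℝ) → ℝ) (x : Pair d) : ℝ :=
  ⨆ w : {w : Pair d // payoffNorm N w ≤ 1}, |pairing w.1 x|

/-- The set `B ∩ C°`, where `B` is the closed unit ball of the dual norm and `C` the target cone. -/
def decisionSet {d : ℕ} (N : (Fin d → ℝ) → ℝ) : Set (Pair d) :=
  {x | dualNorm N x ≤ 1} ∩ polarCone (targetCone N)

/-- The values on `B ∩ C°` of the regularizer `(A/2) ‖z‖₂² + (1/2) ‖z'‖_{q'}²`; the regularizer is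
`+∞` outside `B ∩ C°` and is only ever optimized over `B ∩ C°`. -/
def regularizer {d : ℕ} (A q' : ℝ) (x : Pair d) : ℝ :=
  A / 2 * lpNorm 2 x.1 ^ 2 + 1 / 2 * lpNorm (ENNReal.ofReal q') x.2 ^ 2

/-- `x` attains `max_{x ∈ B ∩ C°} (⟨w, x⟩ - h x)`, where `h` is the regularizer. -/
def IsLeader {d : ℕ} (N : (Fin d → ℝ) → ℝ) (A q' : ℝ) (w x : Pair d) : Prop :=
  x ∈ decisionSet N ∧
    IsMaxOn (fun u : Pair d => pairing w u - regularizer A q' u) (decisionSet N) x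

/-- `a` attains `min_{a ∈ Δ_d} ∑ᵢ max (0, zᵢ aᵢ + z'ᵢ)`, where `x = (z, z')`. -/
def IsOracleAction {d : ℕ} (x : Pair d) (a : Fin d → ℝ) : Prop :=
  a ∈ stdSimplex ℝ (Fin d) ∧
    IsMinOn (fun b : Fin d → ℝ => ∑ i, max 0 (x.1 i * b i + x.2 i)) (stdSimplex ℝ (Fin d)) a

/-- `x 1, a 1, x 2, a 2, …` are computed by the FTRL algorithm with parameters `A`, `q'`, `η`
while the Environment plays `ℓ 1, ℓ 2, …`. Entries with index `0` of `x`, `a`, `ℓ` are not used,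
and `η 0` is immaterial because it multiplies an empty sum. The sequence `ℓ` is unrestricted here,
so that `ℓ t` may depend on everything that precedes it in the play. -/
def IsFTRLPlay {d : ℕ} (N : (Fin d → ℝ) → ℝ) (A q' : ℝ) (η : ℕ → ℝ)
    (x : ℕ → Pair d) (a ℓ : ℕ → Fin d → ℝ) : Prop :=
  ∀ t : ℕ, 1 ≤ t →
    IsLeader N A q' (η (t - 1) • ∑ s ∈ Finset.Icc 1 (t - 1), payoff (a s) (ℓ s)) (x t) ∧
    IsOracleAction (x t) (a t)

end GlobalCost

end

/-!
The regret is controlled through the linear functionals of the decision set `X = B ∩ C°`.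

*Duality.* For an average payoff `(y, y')`, let `z` be a norming dual vector of `y` and `u` a
supergradient at `y'` of the concave function `minCost`. Then `(z, -u)` lies in `X`, and its pairing
with `(y, y')` is at least `‖y‖_p - minCost y'`, the average regret
(`exists_mem_decisionSet_le_pairing`). So no general distance-to-a-cone duality is needed; the
supergradient is explicit, because `minCost y' = (∑ᵢ y'ᵢ^{-q})^{-1/q}` for positive `y'`, with `q`
conjugate to `p`.

*Oracle.* A point of `C°` admits an action `b` with `zᵢ bᵢ + z'ᵢ ≤ 0` for all `i`
(`exists_forall_mul_add_nonpos`), hence the minimum defining `a_t` is `0` and `⟨r_t, x_t⟩ ≤ 0`.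

*Follow the regularized leader.* The inequality of Ball, Carlen and Lieb
`‖x + y‖² + ‖x - y‖² ≥ 2 ‖x‖² + 2 (q - 1) ‖y‖²` in `ℓ_q`, `1 < q ≤ 2` (`sq_lpNorm_add_sub`), makes
the regularizer uniformly convex. Comparing a leader with midpoints gives quadratic growth at the
leader (`IsLeader.growth`), which yields uniqueness of the leader and, by induction on the number of
stages, `⟨∑_{t ≤ T} r_t, u⟩ ≤ h(u) / η_T + (1 / A + e (2 log d - 1)) ∑_{t < T} η_t` on
`X`, with `η_0 = η_1` (`IsFTRLPlay.pairing_sum_le`). Since `h ≤ 1` on `X` (`regularizer_le_one`) and both terms of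
`1 / A + e (2 log d - 1)` are at most `M = max {d^{2/p-1}, e (2 log d - 1)}`, this is at most
`4 √(T M)`. The midpoint argument loses a factor `2` against the sharp strong convexity constant,
which the constant `4` accommodates.
-/

noncomputable section

namespace GlobalCost

/-! ### Uniform convexity of the `ℓ_q` norm -/

lemma two_le_rpow_neg_add {k s : ℝ} (hk0 : 0 ≤ k) (hk1 : k ≤ 1) (hs0 : 0 ≤ s) (hs1 : s < 1) :
    2 ≤ (1 + s) ^ (-k) + (1 - s) ^ (-k) := by
  have h1 : (1 + s) ^ k ≤ 1 + k * s :=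
    rpow_one_add_le_one_add_mul_self (by linarith) hk0 hk1
  have h2 : (1 - s) ^ k ≤ 1 - k * s := by
    have := rpow_one_add_le_one_add_mul_self (s := -s) (by linarith) hk0 hk1
    simpa [sub_eq_add_neg] using this
  have hks : k * s < 1 := by nlinarith
  have hks0 : 0 ≤ k * s := by positivity
  have p1 : 0 < (1 + s) ^ k := Real.rpow_pos_of_pos (by linarith) _
  have p2 : 0 < (1 - s) ^ k := Real.rpow_pos_of_pos (by linarith) _
  rw [Real.rpow_neg (by linarith), Real.rpow_neg (by linarith)]
  have i1 := inv_anti₀ p1 h1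
  have i2 := inv_anti₀ p2 h2
  have i3 : 2 ≤ (1 + k * s)⁻¹ + (1 - k * s)⁻¹ := by
    rw [inv_add_inv (by linarith) (by linarith), le_div_iff₀ (by nlinarith)]
    nlinarith [sq_nonneg (k * s)]
  linarith

lemma two_mul_le_rpow_sub_rpow {r s : ℝ} (hr0 : 0 ≤ r) (hr1 : r ≤ 1) (hs0 : 0 ≤ s) (hs1 : s < 1) :
    2 * r * s ≤ (1 + s) ^ r - (1 - s) ^ r := by
  have hd : ∀ x ∈ Set.Ico (0 : ℝ) 1, HasDerivAt (fun x : ℝ => (1 + x) ^ r - (1 - x) ^ r - 2 * r * x)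
      (1 * r * (1 + x) ^ (r - 1) - (-1) * r * (1 - x) ^ (r - 1) - 2 * r * 1) x := by
    intro x hx
    refine HasDerivAt.sub (HasDerivAt.sub ?_ ?_) ?_
    · exact ((hasDerivAt_id x).const_add 1).rpow_const (Or.inl (by simp; linarith [hx.1]))
    · exact ((hasDerivAt_id x).const_sub 1).rpow_const (Or.inl (by simp; linarith [hx.2]))
    · exact (hasDerivAt_id x).const_mul _
  have hm : MonotoneOn (fun x : ℝ => (1 + x) ^ r - (1 - x) ^ r - 2 * r * x) (Set.Ico (0 : ℝ) 1) := by
    refine monotoneOn_of_deriv_nonneg (convex_Ico 0 1)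
      (fun x hx => (hd x hx).continuousAt.continuousWithinAt)
      (fun x hx => (hd x (interior_subset hx)).differentiableAt.differentiableWithinAt) ?_
    intro x hx
    rw [(hd x (interior_subset hx)).deriv]
    rw [interior_Ico] at hx
    have := two_le_rpow_neg_add (k := 1 - r) (by linarith) (by linarith) hx.1.le hx.2
    rw [neg_sub] at this
    nlinarith
  have := hm ⟨le_rfl, one_pos⟩ ⟨hs0, hs1⟩ hs0
  simp at this
  linarith

lemma two_add_le_rpow_add_rpow {q s : ℝ} (hq1 : 1 ≤ q) (hq2 : q ≤ 2) (hs0 : 0 ≤ s) (hs1 : s ≤ 1) :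
    2 + q * (q - 1) * s ^ 2 ≤ (1 + s) ^ q + (1 - s) ^ q := by
  have hd : ∀ x : ℝ, HasDerivAt
      (fun x : ℝ => (1 + x) ^ q + (1 - x) ^ q - q * (q - 1) * x ^ 2)
      (1 * q * (1 + x) ^ (q - 1) + (-1) * q * (1 - x) ^ (q - 1)
        - q * (q - 1) * (2 * x)) x := by
    intro x
    refine HasDerivAt.sub (HasDerivAt.add ?_ ?_) ?_
    · exact ((hasDerivAt_id x).const_add 1).rpow_const (Or.inr hq1)
    · exact ((hasDerivAt_id x).const_sub 1).rpow_const (Or.inr hq1)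
    · simpa using (hasDerivAt_pow 2 x).const_mul (q * (q - 1))
  have hm : MonotoneOn (fun x : ℝ => (1 + x) ^ q + (1 - x) ^ q - q * (q - 1) * x ^ 2)
      (Set.Icc (0 : ℝ) 1) := by
    refine monotoneOn_of_deriv_nonneg (convex_Icc 0 1)
      (fun x _ => (hd x).continuousAt.continuousWithinAt)
      (fun x _ => (hd x).differentiableAt.differentiableWithinAt) ?_
    intro x hx
    rw [(hd x).deriv]
    rw [interior_Icc] at hx
    have := two_mul_le_rpow_sub_rpow (r := q - 1) (by linarith) (by linarith) hx.1.le hx.2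
    nlinarith
  have := hm ⟨le_rfl, zero_le_one⟩ ⟨hs0, hs1⟩ hs0
  simp at this
  linarith

/-- The two-point inequality when the second vector is the smaller one. After scaling it follows
from `two_add_le_rpow_add_rpow` and Bernoulli's inequality for the exponent `q / 2 ≤ 1`. -/
lemma two_point_of_le {q a b : ℝ} (hq1 : 1 ≤ q) (hq2 : q ≤ 2) (hb : 0 ≤ b) (hab : b ≤ a) :
    2 * (a ^ 2 + (q - 1) * b ^ 2) ^ (q / 2) ≤ (a + b) ^ q + (a - b) ^ q := by
  rcases eq_or_lt_of_le (hb.trans hab) with h0 | ha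
  · subst h0
    obtain rfl : b = 0 := le_antisymm hab hb
    simp [Real.zero_rpow (by positivity : q ≠ 0), Real.zero_rpow (by positivity : q / 2 ≠ 0)]
  set s := b / a with hs
  have hs0 : 0 ≤ s := by positivity
  have hs1 : s ≤ 1 := (div_le_one ha).2 hab
  have hbs : b = a * s := by rw [hs]; field_simp
  have key := two_add_le_rpow_add_rpow hq1 hq2 hs0 hs1
  have hbern : (1 + (q - 1) * s ^ 2) ^ (q / 2) ≤ 1 + q / 2 * ((q - 1) * s ^ 2) :=
    rpow_one_add_le_one_add_mul_self
      (by nlinarith [sq_nonneg s]) (by linarith) (by linarith)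
  have e1 : a ^ 2 + (q - 1) * b ^ 2 = a ^ 2 * (1 + (q - 1) * s ^ 2) := by rw [hbs]; ring
  have e2 : a + b = a * (1 + s) := by rw [hbs]; ring
  have e3 : a - b = a * (1 - s) := by rw [hbs]; ring
  have e4 : (a ^ 2) ^ (q / 2) = a ^ q := by
    rw [← Real.rpow_natCast, ← Real.rpow_mul ha.le]; congr 1; push_cast; ring
  have hnn : 0 ≤ 1 + (q - 1) * s ^ 2 := by nlinarith [sq_nonneg s]
  rw [e1, e2, e3, Real.mul_rpow (by positivity) hnn, Real.mul_rpow ha.le (by linarith),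
    Real.mul_rpow ha.le (by linarith), e4]
  have : 0 < a ^ q := Real.rpow_pos_of_pos ha _
  nlinarith

/-- The two-point inequality of Ball, Carlen and Lieb. -/
lemma two_point {q : ℝ} (hq1 : 1 ≤ q) (hq2 : q ≤ 2) (a b : ℝ) :
    2 * (a ^ 2 + (q - 1) * b ^ 2) ^ (q / 2) ≤ |a + b| ^ q + |a - b| ^ q := by
  have hsum : |a + b| ^ q + |a - b| ^ q =
      (|a| + |b|) ^ q + |(|a| - |b|)| ^ q := by
    rcases le_total 0 a with ha | ha <;> rcases le_total 0 b with hb | hb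
    · rw [abs_of_nonneg ha, abs_of_nonneg hb, abs_of_nonneg (add_nonneg ha hb)]
    · rw [abs_of_nonneg ha, abs_of_nonpos hb, sub_neg_eq_add, ← sub_eq_add_neg,
        abs_of_nonneg (by linarith : 0 ≤ a - b), add_comm]
    · rw [abs_of_nonpos ha, abs_of_nonneg hb, abs_sub_comm a b,
        abs_of_nonneg (by linarith : 0 ≤ b - a), ← abs_neg (a + b), add_comm]
      congr 2 <;> ring_nf
    · rw [abs_of_nonpos ha, abs_of_nonpos hb, abs_of_nonpos (by linarith : a + b ≤ 0),
        ← abs_neg (a - b)]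
      congr 2 <;> ring_nf
  rw [hsum, ← sq_abs a, ← sq_abs b]
  generalize ha : |a| = x
  generalize hb : |b| = y
  have hx : 0 ≤ x := ha ▸ abs_nonneg a
  have hy : 0 ≤ y := hb ▸ abs_nonneg b
  rcases le_total y x with h | h
  · rw [abs_of_nonneg (by linarith : 0 ≤ x - y)]
    exact two_point_of_le hq1 hq2 hy h
  · rw [abs_sub_comm, abs_of_nonneg (by linarith : 0 ≤ y - x), add_comm x y]
    refine le_trans ?_ (two_point_of_le hq1 hq2 hx h)
    have : x ^ 2 + (q - 1) * y ^ 2 ≤ y ^ 2 + (q - 1) * x ^ 2 := by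
      nlinarith [mul_nonneg (sub_nonneg.2 hq2) (sub_nonneg.2 (pow_le_pow_left₀ hx h 2))]
    have h0 : 0 ≤ x ^ 2 + (q - 1) * y ^ 2 := by nlinarith [sq_nonneg x, sq_nonneg y]
    gcongr

/-- Reverse Minkowski inequality for an exponent `r ∈ (0, 1]`, by concavity of `t ↦ t ^ r` after
normalizing the two vectors. -/
lemma rpow_sum_add_le {ι : Type*} (I : Finset ι) {r : ℝ} (hr0 : 0 < r) (hr1 : r ≤ 1) (f g : ι → ℝ)
    (hf : ∀ i ∈ I, 0 ≤ f i) (hg : ∀ i ∈ I, 0 ≤ g i) :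
    (∑ i ∈ I, f i ^ r) ^ (1 / r) + (∑ i ∈ I, g i ^ r) ^ (1 / r) ≤
      (∑ i ∈ I, (f i + g i) ^ r) ^ (1 / r) := by
  have hr' : (1 / r) ≠ 0 := by positivity
  have hF0 : 0 ≤ ∑ i ∈ I, f i ^ r := Finset.sum_nonneg fun i hi => Real.rpow_nonneg (hf i hi) _
  have hG0 : 0 ≤ ∑ i ∈ I, g i ^ r := Finset.sum_nonneg fun i hi => Real.rpow_nonneg (hg i hi) _
  rcases eq_or_lt_of_le hF0 with hF | hF
  · rw [← hF, Real.zero_rpow hr', zero_add]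
    refine Real.rpow_le_rpow hG0 (Finset.sum_le_sum fun i hi => ?_) (by positivity)
    exact Real.rpow_le_rpow (hg i hi) (by linarith [hf i hi]) hr0.le
  rcases eq_or_lt_of_le hG0 with hG | hG
  · rw [← hG, Real.zero_rpow hr', add_zero]
    refine Real.rpow_le_rpow hF0 (Finset.sum_le_sum fun i hi => ?_) (by positivity)
    exact Real.rpow_le_rpow (hf i hi) (by linarith [hg i hi]) hr0.le
  set F := (∑ i ∈ I, f i ^ r) ^ (1 / r) with hFd
  set G := (∑ i ∈ I, g i ^ r) ^ (1 / r) with hGd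
  have hFp : 0 < F := Real.rpow_pos_of_pos hF _
  have hGp : 0 < G := Real.rpow_pos_of_pos hG _
  have hFr : F ^ r = ∑ i ∈ I, f i ^ r := by
    rw [hFd, ← Real.rpow_mul hF0, one_div_mul_cancel hr0.ne', Real.rpow_one]
  have hGr : G ^ r = ∑ i ∈ I, g i ^ r := by
    rw [hGd, ← Real.rpow_mul hG0, one_div_mul_cancel hr0.ne', Real.rpow_one]
  have hconc := Real.concaveOn_rpow hr0.le hr1
  have hterm : ∀ i ∈ I, F / (F + G) * (f i ^ r / F ^ r) + G / (F + G) * (g i ^ r / G ^ r) ≤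
      (f i + g i) ^ r / (F + G) ^ r := by
    intro i hi
    have := hconc.2 (show f i / F ∈ Set.Ici 0 from div_nonneg (hf i hi) hFp.le)
      (show g i / G ∈ Set.Ici 0 from div_nonneg (hg i hi) hGp.le)
      (show 0 ≤ F / (F + G) by positivity) (show 0 ≤ G / (F + G) by positivity) (by field_simp)
    simp only [smul_eq_mul] at this
    rw [Real.div_rpow (hf i hi) hFp.le, Real.div_rpow (hg i hi) hGp.le] at this
    refine this.trans (le_of_eq ?_)
    rw [← Real.div_rpow (add_nonneg (hf i hi) (hg i hi)) (by positivity)]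
    congr 1
    field_simp
  have hsum := Finset.sum_le_sum hterm
  rw [Finset.sum_add_distrib, ← Finset.mul_sum, ← Finset.mul_sum, ← Finset.sum_div,
    ← Finset.sum_div, ← Finset.sum_div, hFr, hGr, div_self hF.ne', div_self hG.ne', mul_one,
    mul_one, ← add_div, div_self (by positivity), le_div_iff₀ (by positivity), one_mul] at hsum
  calc F + G = ((F + G) ^ r) ^ (1 / r) := by
        rw [← Real.rpow_mul (by positivity), mul_one_div_cancel hr0.ne', Real.rpow_one]
    _ ≤ _ := Real.rpow_le_rpow (by positivity) hsum (by positivity)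

lemma lpNorm_ofReal {d : ℕ} {q : ℝ} (hq : 0 < q) (v : Fin d → ℝ) :
    lpNorm (ENNReal.ofReal q) v = (∑ i, |v i| ^ q) ^ (1 / q) := by
  unfold lpNorm
  rw [PiLp.norm_eq_sum (by rwa [ENNReal.toReal_ofReal hq.le])]
  simp [ENNReal.toReal_ofReal hq.le]

lemma sq_lpNorm_ofReal {d : ℕ} {q : ℝ} (hq : 0 < q) (v : Fin d → ℝ) :
    lpNorm (ENNReal.ofReal q) v ^ 2 = (∑ i, |v i| ^ q) ^ (2 / q) := by
  rw [lpNorm_ofReal hq, ← Real.rpow_natCast, ← Real.rpow_mul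
    (Finset.sum_nonneg fun i _ => Real.rpow_nonneg (abs_nonneg _) _)]
  congr 1
  push_cast
  ring

/-- The `ℓ_q` norm, `1 < q ≤ 2`, is 2-uniformly convex with constant `q - 1`. The two-point
inequality is applied in each coordinate; convexity of `t ↦ t ^ (2 / q)` and the reverse Minkowski
inequality in `ℓ_{q/2}` assemble the coordinates. -/
lemma sq_lpNorm_add_sub {d : ℕ} {q : ℝ} (hq1 : 1 < q) (hq2 : q ≤ 2) (x y : Fin d → ℝ) :
    2 * lpNorm (ENNReal.ofReal q) x ^ 2 + 2 * (q - 1) * lpNorm (ENNReal.ofReal q) y ^ 2 ≤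
      lpNorm (ENNReal.ofReal q) (x + y) ^ 2 + lpNorm (ENNReal.ofReal q) (x - y) ^ 2 := by
  have hq0 : 0 < q := by linarith
  have hnn : ∀ v : Fin d → ℝ, 0 ≤ ∑ i, |v i| ^ q :=
    fun v => Finset.sum_nonneg fun i _ => Real.rpow_nonneg (abs_nonneg _) _
  simp only [sq_lpNorm_ofReal hq0]
  have hsq : ∀ t : ℝ, (t ^ 2) ^ (q / 2) = |t| ^ q := by
    intro t
    rw [← sq_abs, ← Real.rpow_natCast, ← Real.rpow_mul (abs_nonneg _)]
    congr 1; push_cast; ring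
  have hmink := rpow_sum_add_le Finset.univ (r := q / 2) (by positivity) (by linarith)
    (fun i => x i ^ 2) (fun i => (q - 1) * y i ^ 2) (fun i _ => sq_nonneg _)
    (fun i _ => mul_nonneg (by linarith) (sq_nonneg _))
  have hexp : 1 / (q / 2) = 2 / q := by field_simp
  simp only [hsq, hexp, Real.mul_rpow (sub_nonneg.2 hq1.le) (sq_nonneg _)] at hmink
  rw [← Finset.mul_sum, Real.mul_rpow (Real.rpow_nonneg (by linarith) _) (hnn y),
    ← Real.rpow_mul (by linarith), (by field_simp : q / 2 * (2 / q) = 1), Real.rpow_one] at hmink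
  have hpt : ∑ i, (x i ^ 2 + (q - 1) * y i ^ 2) ^ (q / 2) ≤
      1 / 2 * ∑ i, |(x + y) i| ^ q + 1 / 2 * ∑ i, |(x - y) i| ^ q := by
    rw [Finset.mul_sum, Finset.mul_sum, ← Finset.sum_add_distrib]
    refine Finset.sum_le_sum fun i _ => ?_
    have := two_point hq1.le hq2 (x i) (y i)
    simp only [Pi.add_apply, Pi.sub_apply]
    linarith
  have hconv := (convexOn_rpow (p := 2 / q) ((one_le_div hq0).2 hq2)).2 (hnn (x + y)) (hnn (x - y))
    (show (0 : ℝ) ≤ 1 / 2 by norm_num) (show (0 : ℝ) ≤ 1 / 2 by norm_num) (by norm_num)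
  simp only [smul_eq_mul] at hconv
  have hmono := Real.rpow_le_rpow (z := 2 / q) (Finset.sum_nonneg fun i _ => Real.rpow_nonneg
    (by nlinarith [sq_nonneg (x i), sq_nonneg (y i)]) _) hpt (by positivity)
  linarith

variable {d : ℕ}

/-! ### The pairing -/

lemma pairing_eq (w x : Pair d) : pairing w x = w.1 ⬝ᵥ x.1 + w.2 ⬝ᵥ x.2 := rfl

lemma pairing_add_left (v w x : Pair d) : pairing (v + w) x = pairing v x + pairing w x := by
  simp only [pairing_eq, Prod.fst_add, Prod.snd_add, add_dotProduct]; ring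

lemma pairing_add_right (w x y : Pair d) : pairing w (x + y) = pairing w x + pairing w y := by
  simp only [pairing_eq, Prod.fst_add, Prod.snd_add, dotProduct_add]; ring

lemma pairing_sub_right (w x y : Pair d) : pairing w (x - y) = pairing w x - pairing w y := by
  simp only [pairing_eq, Prod.fst_sub, Prod.snd_sub, dotProduct_sub]; ring

lemma pairing_smul_left (c : ℝ) (w x : Pair d) : pairing (c • w) x = c * pairing w x := by
  simp only [pairing_eq, Prod.smul_fst, Prod.smul_snd, smul_dotProduct, smul_eq_mul]; ring

lemma pairing_smul_right (c : ℝ) (w x : Pair d) : pairing w (c • x) = c * pairing w x := by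
  simp only [pairing_eq, Prod.smul_fst, Prod.smul_snd, dotProduct_smul, smul_eq_mul]; ring

lemma pairing_zero_left (x : Pair d) : pairing 0 x = 0 := by simp [pairing_eq]

lemma pairing_zero_right (w : Pair d) : pairing w 0 = 0 := by simp [pairing_eq]

lemma continuous_pairing_right (w : Pair d) : Continuous fun x : Pair d => pairing w x := by
  unfold pairing; fun_prop

lemma abs_pairing_le (w x : Pair d) :
    |pairing w x| ≤ ∑ i, |w.1 i| * |x.1 i| + ∑ i, |w.2 i| * |x.2 i| := by
  unfold pairing
  simp only [← abs_mul]
  exact (abs_add_le _ _).trans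
    (add_le_add (Finset.abs_sum_le_sum_abs _ _) (Finset.abs_sum_le_sum_abs _ _))

/-! ### The `ℓ_p` norm -/

section Norm

variable (p : ENNReal) [Fact (1 ≤ p)]

lemma lpNorm_nonneg (v : Fin d → ℝ) : 0 ≤ lpNorm p v := norm_nonneg (WithLp.toLp p v)

lemma lpNorm_zero : lpNorm p (0 : Fin d → ℝ) = 0 := by simp [lpNorm]

lemma lpNorm_smul (c : ℝ) (v : Fin d → ℝ) : lpNorm p (c • v) = |c| * lpNorm p v :=
  norm_smul c (WithLp.toLp p v)

lemma lpNorm_single (i : Fin d) (b : ℝ) : lpNorm p (Pi.single i b) = |b| :=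
  PiLp.norm_single p (fun _ => ℝ) i b

lemma continuous_lpNorm : Continuous fun v : Fin d → ℝ => lpNorm p v :=
  continuous_norm.comp (PiLp.continuous_toLp p _)

lemma abs_apply_le_lpNorm (v : Fin d → ℝ) (i : Fin d) : |v i| ≤ lpNorm p v :=
  PiLp.norm_apply_le (WithLp.toLp p v) i

lemma lpNorm_eq_zero {v : Fin d → ℝ} (h : lpNorm p v = 0) : v = 0 := by
  funext i
  have := abs_apply_le_lpNorm p v i
  rw [h] at this
  exact abs_nonpos_iff.1 this

lemma lpNorm_le_sum_abs (v : Fin d → ℝ) : lpNorm p v ≤ ∑ i, |v i| := by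
  have h : WithLp.toLp p v = ∑ i, WithLp.toLp p (Pi.single i (v i)) := by
    rw [← WithLp.toLp_sum, Finset.univ_sum_single]
  calc lpNorm p v = ‖∑ i, WithLp.toLp p (Pi.single i (v i) : Fin d → ℝ)‖ := by rw [← h]; rfl
    _ ≤ ∑ i, ‖WithLp.toLp p (Pi.single i (v i) : Fin d → ℝ)‖ := norm_sum_le _ _
    _ = ∑ i, |v i| := Finset.sum_congr rfl fun i _ => lpNorm_single p i (v i)

lemma lpNorm_mul_le {a y : Fin d → ℝ} {B : ℝ} (ha : a ∈ stdSimplex ℝ (Fin d))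
    (hy : ∀ i, |y i| ≤ B) : lpNorm p (a * y) ≤ B := by
  refine (lpNorm_le_sum_abs p _).trans ?_
  calc ∑ i, |(a * y) i| ≤ ∑ i, a i * B := by
        refine Finset.sum_le_sum fun i _ => ?_
        rw [Pi.mul_apply, abs_mul, abs_of_nonneg (ha.1 i)]
        exact mul_le_mul_of_nonneg_left (hy i) (ha.1 i)
    _ = B := by rw [← Finset.sum_mul, ha.2, one_mul]

/-- A Hahn–Banach functional norming `y`, written in coordinates. -/
lemma exists_norming_vector (y : Fin d → ℝ) :
    ∃ z : Fin d → ℝ, y ⬝ᵥ z = lpNorm p y ∧ ∀ w : Fin d → ℝ, |w ⬝ᵥ z| ≤ lpNorm p w := by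
  obtain ⟨g, hg1, hg2⟩ := exists_dual_vector'' ℝ (WithLp.toLp p y)
  have hrep : ∀ w : Fin d → ℝ,
      w ⬝ᵥ (fun i => g (WithLp.toLp p (Pi.single i 1))) = g (WithLp.toLp p w) := by
    intro w
    have h : WithLp.toLp p w = ∑ i, w i • WithLp.toLp p (Pi.single i (1 : ℝ)) := by
      simp only [← WithLp.toLp_smul, ← WithLp.toLp_sum]
      congr 1
      funext j
      simp [Finset.sum_apply, Pi.single_apply]
    rw [h, map_sum]
    simp [dotProduct]
  refine ⟨fun i => g (WithLp.toLp p (Pi.single i 1)), ?_, fun w => ?_⟩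
  · rw [hrep, hg2]; rfl
  · rw [hrep]
    calc |g (WithLp.toLp p w)| ≤ ‖g‖ * ‖WithLp.toLp p w‖ := g.le_opNorm _
      _ ≤ 1 * ‖WithLp.toLp p w‖ := by gcongr
      _ = lpNorm p w := one_mul _

/-! ### Static costs -/

lemma bddAbove_maxCost (y : Fin d → ℝ) :
    BddAbove (Set.range fun a : stdSimplex ℝ (Fin d) => lpNorm p (a.1 * y)) := by
  refine ⟨∑ j, |y j|, ?_⟩
  rintro _ ⟨a, rfl⟩
  exact lpNorm_mul_le p a.2 fun i =>
    Finset.single_le_sum (f := fun j => |y j|) (fun j _ => abs_nonneg _) (Finset.mem_univ i)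

lemma bddBelow_minCost (y : Fin d → ℝ) :
    BddBelow (Set.range fun a : stdSimplex ℝ (Fin d) => lpNorm p (a.1 * y)) :=
  ⟨0, by rintro _ ⟨a, rfl⟩; exact lpNorm_nonneg p _⟩

lemma minCost_le {a : Fin d → ℝ} (ha : a ∈ stdSimplex ℝ (Fin d)) (y : Fin d → ℝ) :
    minCost (lpNorm p) y ≤ lpNorm p (a * y) :=
  ciInf_le (bddBelow_minCost p y) ⟨a, ha⟩

lemma minCost_nonneg (y : Fin d → ℝ) : 0 ≤ minCost (lpNorm p) y :=
  Real.iInf_nonneg fun _ => lpNorm_nonneg p _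

lemma maxCost_nonneg (y : Fin d → ℝ) : 0 ≤ maxCost (lpNorm p) y :=
  Real.iSup_nonneg fun _ => lpNorm_nonneg p _

lemma maxCost_le {y : Fin d → ℝ} {B : ℝ} (hB : 0 ≤ B) (hy : ∀ i, |y i| ≤ B) :
    maxCost (lpNorm p) y ≤ B :=
  Real.iSup_le (fun a => lpNorm_mul_le p a.2 hy) hB

lemma single_mul_eq (i : Fin d) (y : Fin d → ℝ) :
    (Pi.single i 1 : Fin d → ℝ) * y = Pi.single i (y i) := by
  funext j
  rcases eq_or_ne j i with rfl | h <;> simp [*]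

lemma minCost_le_abs_apply (y : Fin d → ℝ) (i : Fin d) : minCost (lpNorm p) y ≤ |y i| := by
  have := minCost_le p (single_mem_stdSimplex ℝ i) y
  rwa [single_mul_eq, lpNorm_single] at this

lemma abs_apply_le_maxCost (y : Fin d → ℝ) (i : Fin d) : |y i| ≤ maxCost (lpNorm p) y := by
  have := le_ciSup (bddAbove_maxCost p y) ⟨_, single_mem_stdSimplex ℝ i⟩
  rwa [single_mul_eq, lpNorm_single] at this

lemma exists_minCost_eq [NeZero d] (y : Fin d → ℝ) :
    ∃ a ∈ stdSimplex ℝ (Fin d), lpNorm p (a * y) = minCost (lpNorm p) y := by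
  obtain ⟨a, ha, hmin⟩ := (isCompact_stdSimplex ℝ (Fin d)).exists_isMinOn
    ⟨_, single_mem_stdSimplex ℝ 0⟩
    ((continuous_lpNorm p).comp (continuous_id.mul continuous_const)).continuousOn
  have : Nonempty (stdSimplex ℝ (Fin d)) := ⟨⟨a, ha⟩⟩
  exact ⟨a, ha, le_antisymm (le_ciInf fun b => hmin b.2) (minCost_le p ha y)⟩

end Norm

/-! ### The decision set -/

section DecisionSet

variable (p : ENNReal) [Fact (1 ≤ p)]

lemma payoffNorm_nonneg (w : Pair d) : 0 ≤ payoffNorm (lpNorm p) w :=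
  add_nonneg (lpNorm_nonneg p _) (maxCost_nonneg p _)

lemma maxCost_smul {c : ℝ} (hc : 0 ≤ c) (y : Fin d → ℝ) :
    maxCost (lpNorm p) (c • y) = c * maxCost (lpNorm p) y := by
  unfold maxCost
  rw [Real.mul_iSup_of_nonneg hc]
  congr 1
  funext a
  rw [mul_smul_comm, lpNorm_smul, abs_of_nonneg hc]

lemma payoffNorm_smul {c : ℝ} (hc : 0 ≤ c) (w : Pair d) :
    payoffNorm (lpNorm p) (c • w) = c * payoffNorm (lpNorm p) w := by
  simp only [payoffNorm, Prod.smul_fst, Prod.smul_snd, maxCost_smul p hc, lpNorm_smul,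
    abs_of_nonneg hc]
  ring

lemma abs_fst_apply_le_payoffNorm (w : Pair d) (i : Fin d) :
    |w.1 i| ≤ payoffNorm (lpNorm p) w :=
  (abs_apply_le_lpNorm p w.1 i).trans (le_add_of_nonneg_right (maxCost_nonneg p _))

lemma abs_snd_apply_le_payoffNorm (w : Pair d) (i : Fin d) :
    |w.2 i| ≤ payoffNorm (lpNorm p) w :=
  (abs_apply_le_maxCost p w.2 i).trans (le_add_of_nonneg_left (lpNorm_nonneg p _))

/-- The dual unit ball, described without a supremum. -/
lemma dualNorm_le_one_iff (x : Pair d) :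
    dualNorm (lpNorm p) x ≤ 1 ↔ ∀ w, |pairing w x| ≤ payoffNorm (lpNorm p) w := by
  constructor
  · intro h w
    have hbdd : BddAbove (Set.range
        fun w : {w : Pair d // payoffNorm (lpNorm p) w ≤ 1} => |pairing w.1 x|) := by
      refine ⟨∑ i, 1 * |x.1 i| + ∑ i, 1 * |x.2 i|, ?_⟩
      rintro _ ⟨w, rfl⟩
      refine (abs_pairing_le _ _).trans ?_
      gcongr
      · exact (abs_fst_apply_le_payoffNorm p w.1 _).trans w.2
      · exact (abs_snd_apply_le_payoffNorm p w.1 _).trans w.2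
    rcases eq_or_lt_of_le (payoffNorm_nonneg p w) with h0 | h0
    · have : w = 0 := by
        ext i
        · simpa [← h0] using abs_fst_apply_le_payoffNorm p w i
        · simpa [← h0] using abs_snd_apply_le_payoffNorm p w i
      rw [← h0, this, pairing_zero_left, abs_zero]
    · have hw : payoffNorm (lpNorm p) ((payoffNorm (lpNorm p) w)⁻¹ • w) ≤ 1 := by
        rw [payoffNorm_smul p (by positivity), inv_mul_cancel₀ h0.ne']
      have h1 := (le_ciSup hbdd ⟨_, hw⟩).trans h
      rwa [pairing_smul_left, abs_mul, abs_of_pos (by positivity), inv_mul_le_iff₀ h0,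
        mul_one] at h1
  · intro h
    exact Real.iSup_le (fun w => (h w.1).trans w.2) zero_le_one

lemma mem_decisionSet_iff (x : Pair d) : x ∈ decisionSet (lpNorm p) ↔
    (∀ w, |pairing w x| ≤ payoffNorm (lpNorm p) w) ∧
      ∀ w ∈ targetCone (lpNorm p), pairing w x ≤ 0 := by
  rw [← dualNorm_le_one_iff]; rfl

lemma zero_mem_decisionSet : (0 : Pair d) ∈ decisionSet (lpNorm p) := by
  rw [mem_decisionSet_iff]
  exact ⟨fun w => by simpa [pairing_zero_right] using payoffNorm_nonneg p w,
    fun w _ => (pairing_zero_right w).le⟩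

lemma convex_decisionSet : Convex ℝ (decisionSet (d := d) (lpNorm p)) := by
  intro x hx y hy s t hs ht hst
  rw [mem_decisionSet_iff] at hx hy ⊢
  refine ⟨fun w => ?_, fun w hw => ?_⟩ <;> rw [pairing_add_right, pairing_smul_right,
    pairing_smul_right]
  · calc |s * pairing w x + t * pairing w y| ≤ s * |pairing w x| + t * |pairing w y| := by
          refine (abs_add_le _ _).trans (le_of_eq ?_)
          rw [abs_mul, abs_mul, abs_of_nonneg hs, abs_of_nonneg ht]
      _ ≤ s * payoffNorm (lpNorm p) w + t * payoffNorm (lpNorm p) w := by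
          gcongr
          exacts [hx.1 w, hy.1 w]
      _ = payoffNorm (lpNorm p) w := by rw [← add_mul, hst, one_mul]
  · nlinarith [hx.2 w hw, hy.2 w hw]

lemma isClosed_decisionSet : IsClosed (decisionSet (d := d) (lpNorm p)) := by
  have : decisionSet (d := d) (lpNorm p) =
      (⋂ w, {x | |pairing w x| ≤ payoffNorm (lpNorm p) w}) ∩
        ⋂ w ∈ targetCone (lpNorm p), {x | pairing w x ≤ 0} := by
    ext x
    simp [mem_decisionSet_iff]
  rw [this]
  refine (isClosed_iInter fun w => ?_).inter (isClosed_biInter fun w _ => ?_)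
  · exact isClosed_le (continuous_pairing_right w).abs continuous_const
  · exact isClosed_le (continuous_pairing_right w) continuous_const

/-- Testing against `(z, 0)` bounds the first component of a vector of the dual unit ball. -/
lemma sum_sq_fst_le {x : Pair d} (hx : x ∈ decisionSet (lpNorm p)) :
    ∑ i, x.1 i ^ 2 ≤ lpNorm p x.1 := by
  have h := ((mem_decisionSet_iff p x).1 hx).1 (x.1, 0)
  have h0 : maxCost (lpNorm p) (0 : Fin d → ℝ) ≤ 0 := maxCost_le p le_rfl (by simp)
  have h1 := (le_abs_self _).trans h
  simp only [pairing, payoffNorm, Pi.zero_apply, zero_mul, Finset.sum_const_zero,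
    add_zero, ← pow_two] at h1
  linarith

/-- Testing against sign vectors bounds the `ℓ_1` norm of the second component of a vector of the
dual unit ball. -/
lemma sum_abs_snd_le {x : Pair d} (hx : x ∈ decisionSet (lpNorm p)) : ∑ i, |x.2 i| ≤ 1 := by
  have h := ((mem_decisionSet_iff p x).1 hx).1 (0, fun i => SignType.sign (x.2 i))
  have h0 : maxCost (lpNorm p) (fun i => (SignType.sign (x.2 i) : ℝ)) ≤ 1 := by
    refine maxCost_le p zero_le_one fun i => ?_
    rcases lt_trichotomy (x.2 i) 0 with h | h | h <;> simp [h]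
  have h1 := (le_abs_self _).trans h
  simp only [pairing, payoffNorm, Pi.zero_apply, zero_mul, Finset.sum_const_zero,
    zero_add, lpNorm_zero, sign_mul_self] at h1
  linarith

lemma isCompact_decisionSet : IsCompact (decisionSet (d := d) (lpNorm p)) := by
  refine (isCompact_Icc (a := ((fun _ => -1, fun _ => -1) : Pair d))
    (b := (fun _ => 1, fun _ => 1))).of_isClosed_subset (isClosed_decisionSet p) ?_
  intro x hx
  have h1 : ∀ i, |x.1 i| ≤ 1 := fun i => by
    have h := ((mem_decisionSet_iff p x).1 hx).1 (Pi.single i 1, 0)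
    have h0 : maxCost (lpNorm p) (0 : Fin d → ℝ) ≤ 0 := maxCost_le p le_rfl (by simp)
    simp only [pairing_eq, payoffNorm, single_dotProduct, one_mul, zero_dotProduct, add_zero,
      lpNorm_single, abs_one] at h
    linarith
  have h2 : ∀ i, |x.2 i| ≤ 1 := fun i =>
    (Finset.single_le_sum (f := fun i => |x.2 i|) (fun j _ => abs_nonneg _)
      (Finset.mem_univ i)).trans (sum_abs_snd_le p hx)
  exact ⟨⟨fun i => (abs_le.1 (h1 i)).1, fun i => (abs_le.1 (h2 i)).1⟩,
    ⟨fun i => (abs_le.1 (h1 i)).2, fun i => (abs_le.1 (h2 i)).2⟩⟩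

end DecisionSet

/-! ### Strong convexity of the regularizer -/

lemma sq_lpNorm_two (v : Fin d → ℝ) : lpNorm 2 v ^ 2 = ∑ i, v i ^ 2 := by
  have := PiLp.norm_sq_eq_of_L2 (fun _ : Fin d => ℝ) (WithLp.toLp 2 v)
  simpa [lpNorm] using this

lemma fact_one_le_ofReal {q : ℝ} (hq : 1 < q) : Fact (1 ≤ ENNReal.ofReal q) :=
  ⟨by simpa using hq.le⟩

lemma regularizer_nonneg {A q' : ℝ} (hA : 0 ≤ A) (x : Pair d) : 0 ≤ regularizer A q' x := by
  unfold regularizer; positivity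

lemma continuous_regularizer {A q' : ℝ} (hq : 1 < q') :
    Continuous (regularizer (d := d) A q') := by
  have := fact_one_le_ofReal hq
  exact (continuous_const.mul (((continuous_lpNorm 2).comp continuous_fst).pow 2)).add
    (continuous_const.mul (((continuous_lpNorm _).comp continuous_snd).pow 2))

/-- The modulus of convexity of the regularizer at the difference `δ` of two points. -/
def convexityModulus (A q' : ℝ) (δ : Pair d) : ℝ :=
  A / 4 * lpNorm 2 δ.1 ^ 2 + (q' - 1) / 4 * lpNorm (ENNReal.ofReal q') δ.2 ^ 2

/-- Uniform convexity of the `ℓ_q` norm at the midpoint of two vectors. -/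
lemma sq_lpNorm_midpoint {q : ℝ} (hq1 : 1 < q) (hq2 : q ≤ 2) (x y : Fin d → ℝ) :
    lpNorm (ENNReal.ofReal q) ((1 / 2 : ℝ) • (x + y)) ^ 2 +
        (q - 1) / 4 * lpNorm (ENNReal.ofReal q) (x - y) ^ 2 ≤
      1 / 2 * lpNorm (ENNReal.ofReal q) x ^ 2 + 1 / 2 * lpNorm (ENNReal.ofReal q) y ^ 2 := by
  have := fact_one_le_ofReal hq1
  have h := sq_lpNorm_add_sub hq1 hq2 ((1 / 2 : ℝ) • (x + y)) ((1 / 2 : ℝ) • (x - y))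
  have e1 : (1 / 2 : ℝ) • (x + y) + (1 / 2 : ℝ) • (x - y) = x := by
    funext i; simp; ring
  have e2 : (1 / 2 : ℝ) • (x + y) - (1 / 2 : ℝ) • (x - y) = y := by
    funext i; simp; ring
  rw [e1, e2, lpNorm_smul _ _ (x - y), mul_pow, sq_abs] at h
  linarith

lemma regularizer_midpoint {A q' : ℝ} (hA : 0 ≤ A) (hq1 : 1 < q') (hq2 : q' ≤ 2) (x y : Pair d) :
    regularizer A q' ((1 / 2 : ℝ) • (x + y)) + convexityModulus A q' (x - y) / 2 ≤
      1 / 2 * regularizer A q' x + 1 / 2 * regularizer A q' y := by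
  have h1 := sq_lpNorm_midpoint one_lt_two le_rfl x.1 y.1
  have h2 := sq_lpNorm_midpoint hq1 hq2 x.2 y.2
  rw [ENNReal.ofReal_ofNat] at h1
  simp only [regularizer, convexityModulus, Prod.smul_fst, Prod.smul_snd, Prod.fst_add,
    Prod.snd_add, Prod.fst_sub, Prod.snd_sub]
  nlinarith [mul_le_mul_of_nonneg_left h1 hA]

/-- Quadratic growth at a leader, obtained by comparing it with the midpoint of the leader and
another point of the decision set. -/
lemma IsLeader.growth {p : ENNReal} [Fact (1 ≤ p)] {A q' : ℝ} (hA : 0 ≤ A) (hq1 : 1 < q')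
    (hq2 : q' ≤ 2) {w x u : Pair d} (hx : IsLeader (lpNorm p) A q' w x)
    (hu : u ∈ decisionSet (lpNorm p)) :
    pairing w u - regularizer A q' u + convexityModulus A q' (u - x) ≤
      pairing w x - regularizer A q' x := by
  have hm : (1 / 2 : ℝ) • (u + x) ∈ decisionSet (lpNorm p) := by
    rw [smul_add]
    exact convex_decisionSet p hu hx.1 (by norm_num) (by norm_num) (by norm_num)
  have h1 : pairing w ((1 / 2 : ℝ) • (u + x)) - regularizer A q' ((1 / 2 : ℝ) • (u + x)) ≤
    pairing w x - regularizer A q' x := hx.2 hm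
  have h2 := regularizer_midpoint hA hq1 hq2 u x
  rw [pairing_smul_right, pairing_add_right] at h1
  linarith

lemma eq_zero_of_convexityModulus_nonpos {A q' : ℝ} (hA : 0 < A) (hq1 : 1 < q') {δ : Pair d}
    (h : convexityModulus A q' δ ≤ 0) : δ = 0 := by
  have := fact_one_le_ofReal hq1
  unfold convexityModulus at h
  have h1 : 0 ≤ A / 4 * lpNorm 2 δ.1 ^ 2 := by positivity
  have hq : 0 < (q' - 1) / 4 := by linarith
  have h2 : 0 ≤ (q' - 1) / 4 * lpNorm (ENNReal.ofReal q') δ.2 ^ 2 := by positivity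
  have h1' : A / 4 * lpNorm 2 δ.1 ^ 2 = 0 := by linarith
  have h2' : (q' - 1) / 4 * lpNorm (ENNReal.ofReal q') δ.2 ^ 2 = 0 := by linarith
  refine Prod.ext (lpNorm_eq_zero 2 ?_) (lpNorm_eq_zero (ENNReal.ofReal q') ?_)
  · simpa [hA.ne'] using h1'
  · simpa [sub_ne_zero.2 hq1.ne'] using h2'

lemma existsUnique_isLeader (p : ENNReal) [Fact (1 ≤ p)] {A q' : ℝ} (hA : 0 < A) (hq1 : 1 < q')
    (hq2 : q' ≤ 2) (w : Pair d) : ∃! x, IsLeader (lpNorm p) A q' w x := by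
  obtain ⟨x, hx, hmax⟩ := (isCompact_decisionSet p).exists_isMaxOn ⟨0, zero_mem_decisionSet p⟩
    ((continuous_pairing_right w).sub (continuous_regularizer (A := A) hq1)).continuousOn
  refine ⟨x, ⟨hx, hmax⟩, fun y hy => ?_⟩
  have h1 := IsLeader.growth hA.le hq1 hq2 (show IsLeader (lpNorm p) A q' w x from ⟨hx, hmax⟩) hy.1
  have h2 : pairing w x - regularizer A q' x ≤ pairing w y - regularizer A q' y := hy.2 hx
  exact sub_eq_zero.1 (eq_zero_of_convexityModulus_nonpos hA hq1 (by linarith))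

/-! ### Size of the regularizer and of the payoffs -/

/-- Hölder's inequality against the constant vector. -/
lemma sum_abs_le_rpow_mul_lpNorm {q : ℝ} (hq : 1 ≤ q) (v : Fin d → ℝ) :
    ∑ i, |v i| ≤ (d : ℝ) ^ (1 - 1 / q) * lpNorm (ENNReal.ofReal q) v := by
  have hq0 : 0 < q := by linarith
  have h := Real.rpow_sum_le_const_mul_sum_rpow Finset.univ v hq
  rw [Finset.card_univ, Fintype.card_fin] at h
  have hs : 0 ≤ ∑ i, |v i| := Finset.sum_nonneg fun i _ => abs_nonneg _
  have h1 := Real.rpow_le_rpow (z := 1 / q) (by positivity) h (by positivity)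
  rw [← Real.rpow_mul hs, mul_one_div_cancel hq0.ne', Real.rpow_one,
    Real.mul_rpow (by positivity) (Finset.sum_nonneg fun i _ => Real.rpow_nonneg (abs_nonneg _) _),
    ← Real.rpow_mul (Nat.cast_nonneg _), ← lpNorm_ofReal hq0] at h1
  convert h1 using 3
  field_simp

lemma sq_lpNorm_le_sum_sq_of_two_le {q : ℝ} (hq : 2 ≤ q) (v : Fin d → ℝ) :
    lpNorm (ENNReal.ofReal q) v ^ 2 ≤ ∑ i, v i ^ 2 := by
  have hq0 : 0 < q := by linarith
  set s := ∑ i, v i ^ 2 with hs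
  have hs0 : 0 ≤ s := Finset.sum_nonneg fun i _ => sq_nonneg _
  have key : ∑ i, |v i| ^ q ≤ s ^ (q / 2) := by
    have hterm : ∀ i, |v i| ^ q ≤ v i ^ 2 * s ^ (q / 2 - 1) := by
      intro i
      have hi : v i ^ 2 ≤ s :=
        Finset.single_le_sum (f := fun i => v i ^ 2) (fun j _ => sq_nonneg _) (Finset.mem_univ i)
      have e : |v i| ^ q = v i ^ 2 * (v i ^ 2) ^ (q / 2 - 1) := by
        rcases eq_or_ne (v i) 0 with h | h
        · simp [h, hq0.ne']
        · have hp : 0 < v i ^ 2 := by positivity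
          rw [← Real.rpow_one_add' hp.le (by linarith), ← sq_abs, ← Real.rpow_natCast,
            ← Real.rpow_mul (abs_nonneg _)]
          congr 1; push_cast; ring
      rw [e]
      exact mul_le_mul_of_nonneg_left
        (Real.rpow_le_rpow (sq_nonneg _) hi (by linarith)) (sq_nonneg _)
    calc ∑ i, |v i| ^ q ≤ ∑ i, v i ^ 2 * s ^ (q / 2 - 1) := Finset.sum_le_sum fun i _ => hterm i
      _ = s * s ^ (q / 2 - 1) := by rw [← Finset.sum_mul]
      _ = s ^ (q / 2) := by
          rw [← Real.rpow_one_add' hs0 (by linarith)]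
          congr 1; ring
  rw [sq_lpNorm_ofReal hq0]
  calc (∑ i, |v i| ^ q) ^ (2 / q) ≤ (s ^ (q / 2)) ^ (2 / q) :=
        Real.rpow_le_rpow (Finset.sum_nonneg fun i _ => Real.rpow_nonneg (abs_nonneg _) _) key
          (by positivity)
    _ = s := by rw [← Real.rpow_mul hs0, (by field_simp : q / 2 * (2 / q) = 1), Real.rpow_one]

lemma sq_lpNorm_le_rpow_mul_sum_sq {q : ℝ} (hq0 : 0 < q) (hq : q ≤ 2) (v : Fin d → ℝ) :
    lpNorm (ENNReal.ofReal q) v ^ 2 ≤ (d : ℝ) ^ (2 / q - 1) * ∑ i, v i ^ 2 := by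
  have h := Real.rpow_sum_le_const_mul_sum_rpow Finset.univ (fun i => |v i| ^ q)
    ((one_le_div hq0).2 hq)
  rw [Finset.card_univ, Fintype.card_fin] at h
  rw [sq_lpNorm_ofReal hq0]
  refine le_trans (le_of_eq ?_) (h.trans (le_of_eq ?_))
  · simp only [abs_of_nonneg (Real.rpow_nonneg (abs_nonneg (v _)) q)]
  · congr 1
    refine Finset.sum_congr rfl fun i _ => ?_
    rw [abs_of_nonneg (Real.rpow_nonneg (abs_nonneg _) _), ← Real.rpow_mul (abs_nonneg _),
      mul_div_cancel₀ _ hq0.ne', Real.rpow_ofNat, sq_abs]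

lemma lpNorm_top_le {v : Fin d → ℝ} {B : ℝ} (hB : 0 ≤ B) (h : ∀ i, |v i| ≤ B) :
    lpNorm ⊤ v ≤ B := by
  unfold lpNorm
  rw [PiLp.norm_eq_ciSup]
  exact Real.iSup_le h hB

/-- The comparison of the `ℓ_p` and the Euclidean norm, for every extended exponent `p ≥ 1`. -/
lemma min_mul_sq_lpNorm_le {p : ENNReal} (hp : 1 ≤ p) (hd : 0 < d) (v : Fin d → ℝ) :
    min ((d : ℝ) ^ (1 - 2 * (p⁻¹).toReal)) 1 * lpNorm p v ^ 2 ≤ ∑ i, v i ^ 2 := by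
  have hd' : (0 : ℝ) < d := by exact_mod_cast hd
  have : Fact (1 ≤ p) := ⟨hp⟩
  have hs0 : 0 ≤ ∑ i, v i ^ 2 := Finset.sum_nonneg fun i _ => sq_nonneg _
  rcases eq_or_ne p ⊤ with rfl | hpt
  · have h1 : lpNorm ⊤ v ≤ √(∑ i, v i ^ 2) := by
      refine lpNorm_top_le (Real.sqrt_nonneg _) fun i => Real.abs_le_sqrt ?_
      exact Finset.single_le_sum (f := fun i => v i ^ 2) (fun j _ => sq_nonneg _)
        (Finset.mem_univ i)
    have h2 := pow_le_pow_left₀ (lpNorm_nonneg ⊤ v) h1 2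
    rw [Real.sq_sqrt hs0] at h2
    exact (mul_le_of_le_one_left (sq_nonneg _) (min_le_right _ _)).trans h2
  · set q := p.toReal with hq
    have hpq : p = ENNReal.ofReal q := (ENNReal.ofReal_toReal hpt).symm
    have hq1 : 1 ≤ q := by
      rw [hq, ← ENNReal.toReal_one]
      exact (ENNReal.toReal_le_toReal ENNReal.one_ne_top hpt).2 hp
    rw [ENNReal.toReal_inv, ← hq, hpq]
    rcases le_total q 2 with h | h
    · calc min ((d : ℝ) ^ (1 - 2 * q⁻¹)) 1 * lpNorm (ENNReal.ofReal q) v ^ 2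
          ≤ (d : ℝ) ^ (1 - 2 * q⁻¹) * ((d : ℝ) ^ (2 / q - 1) * ∑ i, v i ^ 2) :=
            mul_le_mul (min_le_left _ _) (sq_lpNorm_le_rpow_mul_sum_sq (by linarith) h v)
              (sq_nonneg _) (Real.rpow_nonneg hd'.le _)
        _ = ∑ i, v i ^ 2 := by
            rw [← mul_assoc, ← Real.rpow_add hd',
              (by ring : 1 - 2 * q⁻¹ + (2 / q - 1) = 0), Real.rpow_zero, one_mul]
    · exact (mul_le_of_le_one_left (sq_nonneg _) (min_le_right _ _)).trans
        (sq_lpNorm_le_sum_sq_of_two_le h v)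

lemma lpNorm_ofReal_le_sum_abs {q : ℝ} (hq : 1 < q) (v : Fin d → ℝ) :
    lpNorm (ENNReal.ofReal q) v ≤ ∑ i, |v i| :=
  have := fact_one_le_ofReal hq
  lpNorm_le_sum_abs _ v

lemma regularizer_le_one {p : ENNReal} (hp : 1 ≤ p) (hd : 0 < d) {q' : ℝ} (hq : 1 < q')
    {x : Pair d} (hx : x ∈ decisionSet (lpNorm p)) :
    regularizer (min ((d : ℝ) ^ (1 - 2 * (p⁻¹).toReal)) 1) q' x ≤ 1 := by
  have : Fact (1 ≤ p) := ⟨hp⟩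
  have h1 := min_mul_sq_lpNorm_le hp hd x.1
  have h2 := sum_sq_fst_le p hx
  have hd' : (0 : ℝ) < d := by exact_mod_cast hd
  have hA : 0 < min ((d : ℝ) ^ (1 - 2 * (p⁻¹).toReal)) 1 :=
    lt_min (Real.rpow_pos_of_pos hd' _) one_pos
  unfold regularizer
  rw [sq_lpNorm_two]
  generalize min ((d : ℝ) ^ (1 - 2 * (p⁻¹).toReal)) 1 = A at *
  have hs0 : 0 ≤ ∑ i, x.1 i ^ 2 := Finset.sum_nonneg fun i _ => sq_nonneg _
  -- `A s² ≤ A ‖z‖_p² ≤ s` for `s = ‖z‖₂²`, hence `A s ≤ 1`.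
  have h3 : A * ∑ i, x.1 i ^ 2 ≤ 1 := by
    rcases eq_or_lt_of_le hs0 with h | h
    · rw [← h]; simp
    · have h4 : A * (∑ i, x.1 i ^ 2) ^ 2 ≤ ∑ i, x.1 i ^ 2 :=
        (mul_le_mul_of_nonneg_left (pow_le_pow_left₀ hs0 h2 2) hA.le).trans h1
      by_contra! h5
      nlinarith
  have h4 : lpNorm (ENNReal.ofReal q') x.2 ^ 2 ≤ 1 := by
    have := fact_one_le_ofReal hq
    exact pow_le_one₀ (lpNorm_nonneg _ _)
      ((lpNorm_ofReal_le_sum_abs hq x.2).trans (sum_abs_snd_le p hx))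
  linarith

/-- The Fenchel–Young inequality for the modulus of convexity: the payoffs have squared dual norm
at most `1` in the first component and at most `E` in the second one. -/
lemma pairing_payoff_le {A q' E c : ℝ} (hA : 0 < A) (hq : 1 < q') (hc : 0 < c)
    (hE : ((d : ℝ) ^ (1 - 1 / q')) ^ 2 ≤ E) {a ℓ : Fin d → ℝ} (ha : a ∈ stdSimplex ℝ (Fin d))
    (hℓ : ℓ ∈ Set.Icc (0 : Fin d → ℝ) 1) (δ : Pair d) :
    pairing (payoff a ℓ) δ ≤ c * convexityModulus A q' δ + (1 / A + E / (q' - 1)) / c := by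
  have := fact_one_le_ofReal hq
  have hq0 : 0 < q' - 1 := by linarith
  have h1 : ∑ i, (a * ℓ) i * δ.1 i ≤ c * (A / 4 * lpNorm 2 δ.1 ^ 2) + 1 / A / c := by
    have hterm : ∀ i, (a * ℓ) i * δ.1 i ≤ c * A / 4 * δ.1 i ^ 2 + 1 / (A * c) * a i := by
      intro i
      have e0 : (a * ℓ) i ^ 2 ≤ a i := by
        have hai : a i ≤ 1 := ha.2 ▸
          Finset.single_le_sum (f := a) (fun j _ => ha.1 j) (Finset.mem_univ i)
        have hl0 := hℓ.1 i
        have hl1 := hℓ.2 i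
        simp only [Pi.zero_apply, Pi.one_apply] at hl0 hl1
        rw [Pi.mul_apply, mul_pow]
        nlinarith [ha.1 i, pow_le_one₀ hl0 hl1 (n := 2), mul_nonneg (ha.1 i) (sub_nonneg.2 hai)]
      have e1 : (a * ℓ) i * δ.1 i ≤ c * A / 4 * δ.1 i ^ 2 + 1 / (A * c) * (a * ℓ) i ^ 2 := by
        have hAc : 0 < A * c := by positivity
        have := sq_nonneg (A * c * δ.1 i - 2 * (a * ℓ) i)
        rw [← sub_nonneg]
        have e2 : c * A / 4 * δ.1 i ^ 2 + 1 / (A * c) * (a * ℓ) i ^ 2 - (a * ℓ) i * δ.1 i =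
            (A * c * δ.1 i - 2 * (a * ℓ) i) ^ 2 / (4 * (A * c)) := by
          field_simp; ring
        rw [e2]; positivity
      have : 1 / (A * c) * (a * ℓ) i ^ 2 ≤ 1 / (A * c) * a i :=
        mul_le_mul_of_nonneg_left e0 (by positivity)
      linarith
    refine (Finset.sum_le_sum fun i _ => hterm i).trans (le_of_eq ?_)
    rw [Finset.sum_add_distrib, ← Finset.mul_sum, ← Finset.mul_sum, ha.2, sq_lpNorm_two]
    field_simp
  have h2 : ∑ i, ℓ i * δ.2 i ≤
      c * ((q' - 1) / 4 * lpNorm (ENNReal.ofReal q') δ.2 ^ 2) + E / (q' - 1) / c := by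
    have e0 : ∑ i, ℓ i * δ.2 i ≤ ∑ i, |δ.2 i| := by
      refine Finset.sum_le_sum fun i _ => ?_
      have hl0 := hℓ.1 i
      have hl1 := hℓ.2 i
      simp only [Pi.zero_apply, Pi.one_apply] at hl0 hl1
      calc ℓ i * δ.2 i ≤ ℓ i * |δ.2 i| := mul_le_mul_of_nonneg_left (le_abs_self _) hl0
        _ ≤ |δ.2 i| := mul_le_of_le_one_left (abs_nonneg _) hl1
    refine (e0.trans (sum_abs_le_rpow_mul_lpNorm hq.le δ.2)).trans ?_
    set n := lpNorm (ENNReal.ofReal q') δ.2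
    set D := (d : ℝ) ^ (1 - 1 / q')
    have e1 : c * ((q' - 1) / 4 * n ^ 2) + D ^ 2 / (q' - 1) / c - D * n =
        ((q' - 1) * c * n - 2 * D) ^ 2 / (4 * ((q' - 1) * c)) := by
      field_simp; ring
    have e2 : 0 ≤ ((q' - 1) * c * n - 2 * D) ^ 2 / (4 * ((q' - 1) * c)) := by positivity
    have e3 : D ^ 2 / (q' - 1) / c ≤ E / (q' - 1) / c := by gcongr
    linarith
  have h3 : pairing (payoff a ℓ) δ = ∑ i, (a * ℓ) i * δ.1 i + ∑ i, ℓ i * δ.2 i := rfl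
  rw [h3, convexityModulus, add_div]
  linarith

/-! ### The oracle action -/

lemma exists_isOracleAction [NeZero d] (x : Pair d) : ∃ a, IsOracleAction x a := by
  obtain ⟨a, ha, hmin⟩ := (isCompact_stdSimplex ℝ (Fin d)).exists_isMinOn
    (f := fun b : Fin d → ℝ => ∑ i, max 0 (x.1 i * b i + x.2 i))
    ⟨_, single_mem_stdSimplex ℝ 0⟩ (by fun_prop)
  exact ⟨a, ha, hmin⟩

/-- Blackwell's condition. If some `zᵢ ≤ 0`, the vertex `i` works since `z' ≤ 0`. Otherwise the loss
vector `ℓᵢ = 1 / zᵢ` and its best static action give `1 ≤ ∑ᵢ -z'ᵢ / zᵢ`, which leaves room for an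
action with `aᵢ ≤ -z'ᵢ / zᵢ` for all `i`. -/
lemma exists_forall_mul_add_nonpos (p : ENNReal) [Fact (1 ≤ p)] [NeZero d] {x : Pair d}
    (hx : x ∈ polarCone (targetCone (lpNorm p))) :
    ∃ b ∈ stdSimplex ℝ (Fin d), ∀ i, x.1 i * b i + x.2 i ≤ 0 := by
  have hz' : ∀ i, x.2 i ≤ 0 := by
    intro i
    have h := hx (0, Pi.single i 1) ⟨le_rfl, Pi.single_nonneg.2 zero_le_one,
      by simpa [lpNorm_zero] using minCost_nonneg p _⟩
    simpa [pairing_eq] using h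
  by_cases hz : ∃ i, x.1 i ≤ 0
  · obtain ⟨i, hi⟩ := hz
    refine ⟨Pi.single i 1, single_mem_stdSimplex ℝ i, fun j => ?_⟩
    rcases eq_or_ne j i with rfl | hj
    · simpa using add_nonpos hi (hz' j)
    · simpa [hj] using hz' j
  push Not at hz
  obtain ⟨a, ha, hopt⟩ := exists_minCost_eq p (fun i => (x.1 i)⁻¹)
  have hℓ : (0 : Fin d → ℝ) ≤ fun i => (x.1 i)⁻¹ := fun i => (inv_pos.2 (hz i)).le
  have h := hx (a * fun i => (x.1 i)⁻¹, fun i => (x.1 i)⁻¹)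
    ⟨mul_nonneg (fun i => ha.1 i) hℓ, hℓ, hopt.le⟩
  have hs : 1 ≤ ∑ i, -x.2 i / x.1 i := by
    have e : pairing (a * fun i => (x.1 i)⁻¹, fun i => (x.1 i)⁻¹) x =
        1 - ∑ i, -x.2 i / x.1 i := by
      rw [← ha.2, pairing, ← Finset.sum_add_distrib, ← Finset.sum_sub_distrib]
      refine Finset.sum_congr rfl fun i _ => ?_
      have := (hz i).ne'
      simp only [Pi.mul_apply]
      field_simp
      ring
    linarith
  have hterm : ∀ i, 0 ≤ -x.2 i / x.1 i := fun i => div_nonneg (neg_nonneg.2 (hz' i)) (hz i).le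
  refine ⟨fun i => (-x.2 i / x.1 i) / ∑ j, -x.2 j / x.1 j,
    ⟨fun i => div_nonneg (hterm i) (by linarith), ?_⟩, fun i => ?_⟩
  · rw [← Finset.sum_div, div_self (by linarith)]
  · have h1 := div_le_self (hterm i) hs
    have h2 := mul_le_mul_of_nonneg_left h1 (hz i).le
    rw [mul_div_cancel₀ _ (hz i).ne'] at h2
    linarith

lemma IsOracleAction.pairing_payoff_nonpos {p : ENNReal} [Fact (1 ≤ p)] [NeZero d] {x : Pair d}
    {a ℓ : Fin d → ℝ} (ha : IsOracleAction x a) (hx : x ∈ polarCone (targetCone (lpNorm p)))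
    (hℓ : ℓ ∈ Set.Icc (0 : Fin d → ℝ) 1) : pairing (payoff a ℓ) x ≤ 0 := by
  obtain ⟨b, hb, hbx⟩ := exists_forall_mul_add_nonpos p hx
  have h1 : ∑ i, max 0 (x.1 i * a i + x.2 i) ≤ ∑ i, max 0 (x.1 i * b i + x.2 i) := ha.2 hb
  have h2 : ∑ i, max 0 (x.1 i * b i + x.2 i) = 0 :=
    Finset.sum_eq_zero fun i _ => max_eq_left (hbx i)
  have h3 : pairing (payoff a ℓ) x ≤ ∑ i, max 0 (x.1 i * a i + x.2 i) := by
    simp only [pairing, payoff]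
    rw [← Finset.sum_add_distrib]
    refine Finset.sum_le_sum fun i _ => ?_
    have hl0 := hℓ.1 i
    have hl1 := hℓ.2 i
    simp only [Pi.zero_apply, Pi.one_apply] at hl0 hl1
    calc (a * ℓ) i * x.1 i + ℓ i * x.2 i = ℓ i * (x.1 i * a i + x.2 i) := by
          rw [Pi.mul_apply]; ring
      _ ≤ ℓ i * max 0 (x.1 i * a i + x.2 i) := mul_le_mul_of_nonneg_left (le_max_right _ _) hl0
      _ ≤ max 0 (x.1 i * a i + x.2 i) := mul_le_of_le_one_left (le_max_left _ _) hl1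
  linarith

/-! ### Supergradients of the best static cost -/

/-- The real exponent conjugate to an extended exponent `p > 1`. -/
def conjExp (p : ENNReal) : ℝ := (1 - (p⁻¹).toReal)⁻¹

lemma toReal_inv_lt_one {p : ENNReal} (hp : 1 < p) : (p⁻¹).toReal < 1 := by
  have h : p⁻¹ < 1 := ENNReal.inv_lt_one.2 hp
  simpa using (ENNReal.toReal_lt_toReal h.ne_top ENNReal.one_ne_top).2 h

lemma conjExp_pos {p : ENNReal} (hp : 1 < p) : 0 < conjExp p :=
  inv_pos.2 (sub_pos.2 (toReal_inv_lt_one hp))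

lemma inv_conjExp (p : ENNReal) : (conjExp p)⁻¹ = 1 - (p⁻¹).toReal := inv_inv _

lemma conjExp_top : conjExp ⊤ = 1 := by simp [conjExp]

lemma holderConjugate_conjExp {p : ENNReal} (hp : 1 < p) (hpt : p ≠ ⊤) :
    p.toReal.HolderConjugate (conjExp p) := by
  have h1 : 1 < p.toReal := by
    simpa using (ENNReal.toReal_lt_toReal ENNReal.one_ne_top hpt).2 hp
  rw [Real.holderConjugate_iff]
  exact ⟨h1, by rw [inv_conjExp, ENNReal.toReal_inv]; ring⟩

lemma lpNorm_eq_of_ne_top {p : ENNReal} (hp : 1 < p) (hpt : p ≠ ⊤) (v : Fin d → ℝ) :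
    lpNorm p v = (∑ i, |v i| ^ p.toReal) ^ (1 / p.toReal) := by
  have := lpNorm_ofReal (ENNReal.toReal_pos (zero_lt_one.trans hp).ne' hpt) v
  rwa [ENNReal.ofReal_toReal hpt] at this

/-- Hölder's inequality, including the exponent `p = ∞`. -/
lemma sum_mul_le_lpNorm_mul {p : ENNReal} (hp : 1 < p) {b c : Fin d → ℝ} (hc : 0 ≤ c) :
    ∑ i, b i * c i ≤ lpNorm p b * (∑ i, c i ^ conjExp p) ^ (conjExp p)⁻¹ := by
  have : Fact (1 ≤ p) := ⟨hp.le⟩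
  rcases eq_or_ne p ⊤ with rfl | hpt
  · simp only [conjExp_top, Real.rpow_one, inv_one]
    rw [Finset.mul_sum]
    exact Finset.sum_le_sum fun i _ => mul_le_mul_of_nonneg_right
      ((le_abs_self _).trans (abs_apply_le_lpNorm ⊤ b i)) (hc i)
  · have h := Real.inner_le_Lp_mul_Lq Finset.univ b c (holderConjugate_conjExp hp hpt)
    rw [← lpNorm_eq_of_ne_top hp hpt, one_div] at h
    simpa only [abs_of_nonneg (hc _)] using h

lemma lpNorm_rpow_le {p : ENNReal} (hp : 1 < p) {w : Fin d → ℝ} (hw : ∀ i, 0 < w i) :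
    lpNorm p (fun i => w i ^ (1 - conjExp p)) ≤
      (∑ i, w i ^ (-conjExp p)) ^ (p⁻¹).toReal := by
  rcases eq_or_ne p ⊤ with rfl | hpt
  · refine lpNorm_top_le (by simp) fun i => ?_
    simp [conjExp_top]
  · have hpq := holderConjugate_conjExp hp hpt
    rw [lpNorm_eq_of_ne_top hp hpt, ENNReal.toReal_inv, one_div]
    refine le_of_eq ?_
    congr 1
    refine Finset.sum_congr rfl fun i _ => ?_
    rw [abs_of_nonneg (Real.rpow_nonneg (hw i).le _), ← Real.rpow_mul (hw i).le]
    congr 1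
    have := hpq.mul_eq_add
    linarith

/-- The value `(∑ᵢ wᵢ^{-q})^{-1/q}`, with `q` conjugate to `p`, is attained by the action
proportional to `w^{-q}`. -/
lemma minCost_le_rpow {p : ENNReal} (hp : 1 < p) [NeZero d] {w : Fin d → ℝ}
    (hw : ∀ i, 0 < w i) :
    minCost (lpNorm p) w ≤ (∑ i, w i ^ (-conjExp p)) ^ (-(conjExp p)⁻¹) := by
  have : Fact (1 ≤ p) := ⟨hp.le⟩
  set q := conjExp p with hq
  set S := ∑ i, w i ^ (-q) with hS
  have hSp : 0 < S := Finset.sum_pos (fun i _ => Real.rpow_pos_of_pos (hw i) _)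
    ⟨0, Finset.mem_univ _⟩
  have ha : (fun i => S⁻¹ * w i ^ (-q)) ∈ stdSimplex ℝ (Fin d) :=
    ⟨fun i => mul_nonneg (inv_nonneg.2 hSp.le) (Real.rpow_nonneg (hw i).le _), by
      rw [← Finset.mul_sum, ← hS, inv_mul_cancel₀ hSp.ne']⟩
  have e : (fun i => S⁻¹ * w i ^ (-q)) * w = S⁻¹ • fun i => w i ^ (1 - q) := by
    funext i
    simp only [Pi.mul_apply, Pi.smul_apply, smul_eq_mul]
    rw [sub_eq_add_neg, add_comm, Real.rpow_add_one (hw i).ne', mul_assoc]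
  have h := minCost_le p ha w
  rw [e, lpNorm_smul, abs_of_pos (inv_pos.2 hSp)] at h
  refine (h.trans (mul_le_mul_of_nonneg_left (lpNorm_rpow_le hp hw) (by positivity))).trans
    (le_of_eq ?_)
  rw [← hq, ← hS, ← Real.rpow_neg_one, ← Real.rpow_add hSp]
  congr 1
  rw [hq, inv_conjExp]
  ring

lemma rpow_le_minCost {p : ENNReal} (hp : 1 < p) [NeZero d] {y : Fin d → ℝ}
    (hy : ∀ i, 0 < y i) :
    (∑ i, y i ^ (-conjExp p)) ^ (-(conjExp p)⁻¹) ≤ minCost (lpNorm p) y := by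
  have : Fact (1 ≤ p) := ⟨hp.le⟩
  obtain ⟨a, ha, hopt⟩ := exists_minCost_eq p y
  have hSp : 0 < ∑ i, y i ^ (-conjExp p) := Finset.sum_pos
    (fun i _ => Real.rpow_pos_of_pos (hy i) _) ⟨0, Finset.mem_univ _⟩
  have h := sum_mul_le_lpNorm_mul hp (b := a * y) (c := fun i => (y i)⁻¹)
    (fun i => (inv_pos.2 (hy i)).le)
  have e : ∑ i, (a * y) i * (y i)⁻¹ = 1 := by
    rw [← ha.2]
    refine Finset.sum_congr rfl fun i _ => ?_
    rw [Pi.mul_apply, mul_assoc, mul_inv_cancel₀ (hy i).ne', mul_one]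
  simp only [Real.inv_rpow (hy _).le, ← Real.rpow_neg (hy _).le] at h
  rw [e, hopt] at h
  rwa [Real.rpow_neg hSp.le, inv_le_iff_one_le_mul₀ (Real.rpow_pos_of_pos hSp _)]

/-- At every nonnegative `y` the best static cost has a supergradient, which moreover lies in the
`ℓ_1` ball. If `y i = 0`, the unit vector `e i` is one. Otherwise it is `v ^ (q + 1)`, where `v` is
`1 / y` scaled to unit `ℓ_q` norm, with `q` conjugate to `p`; the supergradient inequality at `w` is
Young's inequality summed over the coordinates of `v` and of `1 / w`, scaled in the same way. -/
lemma exists_supergradient_minCost {p : ENNReal} (hp : 1 < p) [NeZero d] {y : Fin d → ℝ}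
    (hy : 0 ≤ y) :
    ∃ u : Fin d → ℝ, 0 ≤ u ∧ ∑ i, u i ≤ 1 ∧ y ⬝ᵥ u ≤ minCost (lpNorm p) y ∧
      ∀ w : Fin d → ℝ, 0 ≤ w → minCost (lpNorm p) w ≤ w ⬝ᵥ u := by
  have : Fact (1 ≤ p) := ⟨hp.le⟩
  by_cases h0 : ∃ i, y i = 0
  · obtain ⟨i, hi⟩ := h0
    refine ⟨Pi.single i 1, Pi.single_nonneg.2 zero_le_one, by simp, ?_, fun w hw => ?_⟩
    · simpa [hi] using minCost_nonneg p y
    · simpa [abs_of_nonneg (hw i)] using minCost_le_abs_apply p w i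
  push Not at h0
  have hy' : ∀ i, 0 < y i := fun i => lt_of_le_of_ne (hy i) (h0 i).symm
  set q := conjExp p with hq
  have hq0 : 0 < q := conjExp_pos hp
  -- The vector `S^{-1/q} / v`, with `S = ∑ᵢ vᵢ^{-q}`, has unit `ℓ_q` norm.
  have normalize : ∀ v : Fin d → ℝ, (∀ i, 0 < v i) →
      0 < (∑ i, v i ^ (-q)) ^ (-q⁻¹) ∧ ∑ i, ((∑ i, v i ^ (-q)) ^ (-q⁻¹) / v i) ^ q = 1 := by
    intro v hv
    have hSp : 0 < ∑ i, v i ^ (-q) := Finset.sum_pos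
      (fun i _ => Real.rpow_pos_of_pos (hv i) _) ⟨0, Finset.mem_univ _⟩
    have hγ := Real.rpow_pos_of_pos hSp (-q⁻¹)
    refine ⟨hγ, ?_⟩
    have : ∀ i, ((∑ i, v i ^ (-q)) ^ (-q⁻¹) / v i) ^ q = (∑ i, v i ^ (-q))⁻¹ * v i ^ (-q) := by
      intro i
      rw [Real.div_rpow hγ.le (hv i).le, ← Real.rpow_mul hSp.le, neg_mul, inv_mul_cancel₀ hq0.ne',
        Real.rpow_neg_one, Real.rpow_neg (hv i).le, div_eq_mul_inv]
    simp only [this]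
    rw [← Finset.mul_sum, inv_mul_cancel₀ hSp.ne']
  obtain ⟨hγ, hγsum⟩ := normalize y hy'
  have hγle := rpow_le_minCost hp hy'
  rw [← hq] at hγle
  generalize (∑ i, y i ^ (-q)) ^ (-q⁻¹) = γ at hγ hγsum hγle
  have hv : ∀ i, 0 < γ / y i := fun i => div_pos hγ (hy' i)
  refine ⟨fun i => (γ / y i) ^ (q + 1), fun i => Real.rpow_nonneg (hv i).le _, ?_, ?_, ?_⟩
  · rw [← hγsum]
    refine Finset.sum_le_sum fun i _ => ?_
    have h1 : γ / y i ≤ 1 := by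
      have h2 : (γ / y i) ^ q ≤ 1 := hγsum ▸ Finset.single_le_sum
        (f := fun i => (γ / y i) ^ q) (fun j _ => Real.rpow_nonneg (hv j).le _) (Finset.mem_univ i)
      by_contra! h3
      exact absurd h2 (not_le.2 (Real.one_lt_rpow h3 hq0))
    exact Real.rpow_le_rpow_of_exponent_ge (hv i) h1 (by linarith)
  · refine le_trans (le_of_eq ?_) hγle
    have : ∀ i, y i * (γ / y i) ^ (q + 1) = γ * (γ / y i) ^ q := by
      intro i
      rw [Real.rpow_add_one (hv i).ne']
      have := (hy' i).ne'
      field_simp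
    simp only [dotProduct, this]
    rw [← Finset.mul_sum, hγsum, mul_one]
  · intro w hw
    by_cases hw0 : ∃ i, w i = 0
    · obtain ⟨i, hi⟩ := hw0
      have h1 := minCost_le_abs_apply p w i
      rw [hi, abs_zero] at h1
      exact h1.trans (Finset.sum_nonneg fun j _ =>
        mul_nonneg (hw j) (Real.rpow_nonneg (hv j).le _))
    push Not at hw0
    have hw' : ∀ i, 0 < w i := fun i => lt_of_le_of_ne (hw i) (hw0 i).symm
    obtain ⟨hκ, hκsum⟩ := normalize w hw'
    refine (minCost_le_rpow hp hw').trans ?_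
    rw [← hq]
    generalize (∑ i, w i ^ (-q)) ^ (-q⁻¹) = κ at hκ hκsum
    -- Young's inequality for the weights `q / (q + 1)` and `1 / (q + 1)`.
    have young : ∀ i, (γ / y i) ^ q ≤
        q / (q + 1) * ((γ / y i) ^ (q + 1) / (κ / w i)) + 1 / (q + 1) * (κ / w i) ^ q := by
      intro i
      have ht : 0 < κ / w i := div_pos hκ (hw' i)
      generalize κ / w i = t at ht
      have hvi := hv i
      generalize γ / y i = v at hvi
      have h := Real.geom_mean_le_arith_mean2_weighted (w₁ := q / (q + 1)) (w₂ := 1 / (q + 1))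
        (p₁ := v ^ (q + 1) / t) (p₂ := t ^ q) (by positivity) (by positivity) (by positivity)
        (by positivity) (by field_simp)
      refine le_trans (le_of_eq ?_) h
      rw [Real.div_rpow (by positivity) ht.le, ← Real.rpow_mul hvi.le, ← Real.rpow_mul ht.le,
        mul_div_cancel₀ q (by positivity), mul_one_div,
        div_mul_cancel₀ _ (Real.rpow_pos_of_pos ht _).ne']
    have hsum := Finset.sum_le_sum fun i (_ : i ∈ Finset.univ) => young i
    rw [Finset.sum_add_distrib, ← Finset.mul_sum, ← Finset.mul_sum, hγsum, hκsum] at hsum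
    have e : ∑ i, (γ / y i) ^ (q + 1) / (κ / w i) =
        (w ⬝ᵥ fun i => (γ / y i) ^ (q + 1)) / κ := by
      rw [dotProduct, Finset.sum_div]
      refine Finset.sum_congr rfl fun i _ => ?_
      field_simp
    rw [e] at hsum
    have e2 : (1 : ℝ) = q / (q + 1) * 1 + 1 / (q + 1) * 1 := by field_simp
    have h3 : q / (q + 1) * 1 ≤ q / (q + 1) * ((w ⬝ᵥ fun i => (γ / y i) ^ (q + 1)) / κ) := by
      linarith
    have h4 := le_of_mul_le_mul_left h3 (by positivity)
    rwa [one_le_div hκ] at h4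

/-- The regret is bounded by the support function of the decision set at the average payoff
`(y, y')`: pair a norming vector of `y` with the opposite of a supergradient at `y'`. -/
lemma exists_mem_decisionSet_le_pairing {p : ENNReal} (hp : 1 < p) [NeZero d] (y : Fin d → ℝ)
    {y' : Fin d → ℝ} (hy' : 0 ≤ y') :
    ∃ x ∈ decisionSet (lpNorm p), lpNorm p y - minCost (lpNorm p) y' ≤ pairing (y, y') x := by
  have : Fact (1 ≤ p) := ⟨hp.le⟩
  obtain ⟨z, hz, hzle⟩ := exists_norming_vector p y
  obtain ⟨u, hu0, hu1, huy, hule⟩ := exists_supergradient_minCost hp hy'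
  refine ⟨(z, -u), (mem_decisionSet_iff p _).2 ⟨fun w => ?_, fun w hw => ?_⟩, ?_⟩
  · have h1 : |w.2 ⬝ᵥ u| ≤ maxCost (lpNorm p) w.2 := by
      calc |w.2 ⬝ᵥ u| ≤ ∑ i, |w.2 i * u i| := Finset.abs_sum_le_sum_abs _ _
        _ ≤ ∑ i, maxCost (lpNorm p) w.2 * u i := by
            refine Finset.sum_le_sum fun i _ => ?_
            rw [abs_mul, abs_of_nonneg (hu0 i)]
            exact mul_le_mul_of_nonneg_right (abs_apply_le_maxCost p w.2 i) (hu0 i)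
        _ ≤ maxCost (lpNorm p) w.2 := by
            rw [← Finset.mul_sum]
            exact mul_le_of_le_one_right (maxCost_nonneg p _) hu1
    rw [pairing_eq, dotProduct_neg]
    refine (abs_add_le _ _).trans (add_le_add (hzle w.1) ?_)
    rwa [abs_neg]
  · have h1 := (le_abs_self _).trans (hzle w.1)
    have h2 := hule w.2 hw.2.1
    have h3 := hw.2.2
    rw [pairing_eq, dotProduct_neg]
    simp only
    linarith
  · rw [pairing_eq, dotProduct_neg]
    simp only
    linarith

/-! ### Follow the regularized leader -/

/-- The regret of follow-the-regularized-leader against any fixed point `u` of the decision set. The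
weights `c t` are the inverses of the step sizes. In the induction the bound for `u` is reduced to
the bound for the current leader, whose quadratic growth absorbs the new payoff. -/
lemma IsFTRLPlay.pairing_sum_le {p : ENNReal} [Fact (1 ≤ p)] [NeZero d] {A q' E : ℝ} (hA : 0 < A)
    (hq1 : 1 < q') (hq2 : q' ≤ 2) (hE : ((d : ℝ) ^ (1 - 1 / q')) ^ 2 ≤ E)
    {η c : ℕ → ℝ} (hc0 : ∀ t, 0 < c t) (hc : Monotone c) (hη : ∀ t, 1 ≤ t → η t = (c t)⁻¹)
    {x : ℕ → Pair d} {a ℓ : ℕ → Fin d → ℝ}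
    (hℓ : ∀ t : ℕ, 1 ≤ t → ℓ t ∈ Set.Icc (0 : Fin d → ℝ) 1)
    (hplay : IsFTRLPlay (lpNorm p) A q' η x a ℓ) (T : ℕ) {u : Pair d}
    (hu : u ∈ decisionSet (lpNorm p)) :
    pairing (∑ t ∈ Finset.Icc 1 T, payoff (a t) (ℓ t)) u ≤
      c T * regularizer A q' u + (1 / A + E / (q' - 1)) * ∑ t ∈ Finset.range T, (c t)⁻¹ := by
  induction T generalizing u with
  | zero =>
    simpa [pairing_zero_left] using mul_nonneg (hc0 0).le (regularizer_nonneg hA.le u)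
  | succ n ih =>
    rw [Finset.sum_Icc_succ_top (by omega), Finset.sum_range_succ, pairing_add_left]
    obtain ⟨hlead, hact⟩ := hplay (n + 1) (by omega)
    rw [Nat.add_sub_cancel] at hlead
    set S := ∑ t ∈ Finset.Icc 1 n, payoff (a t) (ℓ t) with hS
    have hηS : η n • S = (c n)⁻¹ • S := by
      rcases Nat.eq_zero_or_pos n with h | h
      · rw [hS, h]; simp
      · rw [hη n h]
    rw [hηS] at hlead
    have hgrow := hlead.growth hA.le hq1 hq2 hu
    rw [pairing_smul_left, pairing_smul_left] at hgrow
    have hgrow' := mul_le_mul_of_nonneg_left hgrow (hc0 n).le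
    have e1 : c n * ((c n)⁻¹ * pairing S u - regularizer A q' u +
        convexityModulus A q' (u - x (n + 1))) = pairing S u - c n * regularizer A q' u +
        c n * convexityModulus A q' (u - x (n + 1)) := by
      have := (hc0 n).ne'
      field_simp
    have e2 : c n * ((c n)⁻¹ * pairing S (x (n + 1)) - regularizer A q' (x (n + 1))) =
        pairing S (x (n + 1)) - c n * regularizer A q' (x (n + 1)) := by
      have := (hc0 n).ne'
      field_simp
    rw [e1, e2] at hgrow'
    have hprev := ih hlead.1
    have horacle := hact.pairing_payoff_nonpos hlead.1.2 (hℓ (n + 1) (by omega))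
    have hfen := pairing_payoff_le hA hq1 (hc0 n) hE hact.1 (hℓ (n + 1) (by omega))
      (u - x (n + 1))
    rw [pairing_sub_right, div_eq_mul_inv _ (c n)] at hfen
    have hmono := mul_le_mul_of_nonneg_right (hc n.le_succ) (regularizer_nonneg (q' := q') hA.le u)
    rw [mul_add]
    linarith

lemma sum_inv_sqrt_max_le {T : ℕ} (hT : 1 ≤ T) :
    ∑ t ∈ Finset.range (T + 1), (√(max (t : ℝ) 1))⁻¹ ≤ 2 * √T := by
  induction T, hT using Nat.le_induction with
  | base => simp [Finset.sum_range_succ]; norm_num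
  | succ n hn ih =>
    rw [Finset.sum_range_succ, max_eq_left (by push_cast; linarith [n.cast_nonneg (α := ℝ)])]
    have hn0 : (0 : ℝ) ≤ n := n.cast_nonneg
    have h1 : √((n + 1 : ℕ) : ℝ) ^ 2 = n + 1 := by rw [Real.sq_sqrt (by positivity)]; push_cast; ring
    have h2 : √(n : ℝ) ^ 2 = n := Real.sq_sqrt hn0
    have h3 : 0 < √((n + 1 : ℕ) : ℝ) := Real.sqrt_pos.2 (by positivity)
    have h5 : (√((n + 1 : ℕ) : ℝ))⁻¹ ≤ 2 * √((n + 1 : ℕ) : ℝ) - 2 * √(n : ℝ) := by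
      rw [inv_le_iff_one_le_mul₀ h3]
      nlinarith [sq_nonneg (√((n + 1 : ℕ) : ℝ) - √(n : ℝ))]
    linarith

/-- For step sizes `1 / (2 √(t M))` and a constant `M` that dominates the local terms, the regret
of follow-the-regularized-leader in the decision set is at most `4 √(T M)`. -/
lemma IsFTRLPlay.pairing_sum_le_sqrt {p : ENNReal} [Fact (1 ≤ p)] [NeZero d] {A q' E M : ℝ}
    (hA : 0 < A) (hq1 : 1 < q') (hq2 : q' ≤ 2) (hE : ((d : ℝ) ^ (1 - 1 / q')) ^ 2 ≤ E)
    (hM : 0 < M) (hAE : 1 / A + E / (q' - 1) ≤ 2 * M) {η : ℕ → ℝ}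
    (hη : ∀ t : ℕ, 1 ≤ t → η t = 1 / (2 * √(t * M)))
    {x : ℕ → Pair d} {a ℓ : ℕ → Fin d → ℝ}
    (hℓ : ∀ t : ℕ, 1 ≤ t → ℓ t ∈ Set.Icc (0 : Fin d → ℝ) 1)
    (hplay : IsFTRLPlay (lpNorm p) A q' η x a ℓ) {T : ℕ} (hT : 1 ≤ T) {u : Pair d}
    (hu : u ∈ decisionSet (lpNorm p)) (hu1 : regularizer A q' u ≤ 1) :
    pairing (∑ t ∈ Finset.Icc 1 T, payoff (a t) (ℓ t)) u ≤ 4 * (√T * √M) := by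
  have hsM : 0 < √M := Real.sqrt_pos.2 hM
  -- `c 0` only multiplies an empty sum of payoffs; the choice `c 0 = c 1` keeps `c` positive.
  set c : ℕ → ℝ := fun t => 2 * (√(max (t : ℝ) 1) * √M) with hc
  have hc0 : ∀ t, 0 < c t := fun t => by
    have : 0 < √(max (t : ℝ) 1) := Real.sqrt_pos.2 (by positivity)
    positivity
  have hcm : Monotone c := fun s t hst => by
    have : (s : ℝ) ≤ t := by exact_mod_cast hst
    simp only [hc]
    gcongr
  have hcη : ∀ t, 1 ≤ t → η t = (c t)⁻¹ := fun t ht => by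
    have h1 : (1 : ℝ) ≤ t := by exact_mod_cast ht
    rw [hη t ht, hc, one_div, Real.sqrt_mul (by positivity)]
    simp only [max_eq_left h1]
  have h := hplay.pairing_sum_le hA hq1 hq2 hE hc0 hcm hcη hℓ T hu
  have hT1 : (1 : ℝ) ≤ T := by exact_mod_cast hT
  have hcT : c T = 2 * (√T * √M) := by simp only [hc, max_eq_left hT1]
  have hsum : ∑ t ∈ Finset.range T, (c t)⁻¹ ≤ √T * (√M)⁻¹ := by
    have h1 : ∑ t ∈ Finset.range T, (√(max (t : ℝ) 1))⁻¹ ≤ 2 * √T :=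
      (Finset.sum_le_sum_of_subset_of_nonneg (Finset.range_mono T.le_succ)
        fun _ _ _ => by positivity).trans (sum_inv_sqrt_max_le hT)
    have h2 : ∑ t ∈ Finset.range T, (c t)⁻¹ =
        (1 / 2 * (√M)⁻¹) * ∑ t ∈ Finset.range T, (√(max (t : ℝ) 1))⁻¹ := by
      rw [Finset.mul_sum]
      refine Finset.sum_congr rfl fun t _ => ?_
      simp only [hc, mul_inv]
      ring
    rw [h2]
    calc (1 / 2 * (√M)⁻¹) * ∑ t ∈ Finset.range T, (√(max (t : ℝ) 1))⁻¹
        ≤ (1 / 2 * (√M)⁻¹) * (2 * √T) := by gcongr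
      _ = √T * (√M)⁻¹ := by ring
  have hsum0 : 0 ≤ ∑ t ∈ Finset.range T, (c t)⁻¹ :=
    Finset.sum_nonneg fun t _ => (inv_pos.2 (hc0 t)).le
  have h1 : (1 / A + E / (q' - 1)) * ∑ t ∈ Finset.range T, (c t)⁻¹ ≤ 2 * (√T * √M) :=
    calc _ ≤ 2 * M * (√T * (√M)⁻¹) := by gcongr
      _ = 2 * (√T * √M) := by
        nth_rewrite 1 [← Real.mul_self_sqrt hM.le]
        field_simp
  have h2 : c T * regularizer A q' u ≤ 2 * (√T * √M) := by
    rw [← hcT]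
    exact mul_le_of_le_one_right (hc0 T).le hu1
  linarith

lemma avgRegret_eq {N : (Fin d → ℝ) → ℝ} (a ℓ : ℕ → Fin d → ℝ) (T : ℕ) :
    avgRegret N a ℓ T = N ((T : ℝ)⁻¹ • ∑ t ∈ Finset.Icc 1 T, a t * ℓ t) -
      minCost N ((T : ℝ)⁻¹ • ∑ t ∈ Finset.Icc 1 T, ℓ t) := by
  simp only [avgRegret, minCost, mul_smul_comm, Finset.mul_sum]

/-! ### The constants of the algorithm -/

lemma one_div_min_rpow (hd : 0 < d) (s : ℝ) :
    1 / min ((d : ℝ) ^ (1 - 2 * s)) 1 = max ((d : ℝ) ^ (2 * s - 1)) 1 := by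
  have hd' : (0 : ℝ) < d := by exact_mod_cast hd
  have e : (d : ℝ) ^ (2 * s - 1) = ((d : ℝ) ^ (1 - 2 * s))⁻¹ := by
    rw [← Real.rpow_neg hd'.le, neg_sub]
  have hp := Real.rpow_pos_of_pos hd' (1 - 2 * s)
  rw [e, one_div]
  rcases le_total ((d : ℝ) ^ (1 - 2 * s)) 1 with h | h
  · rw [min_eq_left h, max_eq_left ((one_le_inv₀ hp).2 h)]
  · rw [min_eq_right h, inv_one, max_eq_right (inv_le_one_of_one_le₀ h)]

/-- The exponent conjugate to `q' = 1 + (2 log d - 1)⁻¹` is `2 log d`, so `d` to the power of twice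
its inverse is `e`. -/
lemma sq_rpow_one_sub_inv_eq_exp (hd : 2 ≤ d) {q' : ℝ} (hq' : q' = 1 + (2 * Real.log d - 1)⁻¹)
    (hq1 : 1 < q') : ((d : ℝ) ^ (1 - 1 / q')) ^ 2 = Real.exp 1 := by
  have hd' : (1 : ℝ) < d := by exact_mod_cast hd
  have hlog : 0 < Real.log d := Real.log_pos hd'
  have hm : 0 < 2 * Real.log d - 1 := by
    have : 0 < (2 * Real.log d - 1)⁻¹ := by linarith
    exact inv_pos.1 this
  have e : 1 - 1 / q' = 1 / (2 * Real.log d) := by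
    have hq0 : q' = 2 * Real.log d / (2 * Real.log d - 1) := by
      rw [hq']; field_simp; ring
    rw [hq0, one_div_div]
    field_simp
    ring
  rw [e, Real.rpow_def_of_pos (by linarith), ← Real.exp_nat_mul]
  congr 1
  push_cast
  field_simp

end GlobalCost

end

theorem mainTheorem2 (d : ℕ) (hd : 2 ≤ d) (p : ENNReal) (hp : 1 < p)
    (A q' : ℝ)
    (hA : A = min ((d : ℝ) ^ (1 - 2 * (p⁻¹).toReal)) 1)
    (hq' : q' = 1 + (2 * Real.log d - 1)⁻¹)
    (hq'_mem : q' ∈ Set.Ioc (1 : ℝ) 2)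
    (η : ℕ → ℝ)
    (hη : ∀ t : ℕ, 1 ≤ t → η t =
      1 / (2 * Real.sqrt (t * max ((d : ℝ) ^ (2 * (p⁻¹).toReal - 1))
        (Real.exp 1 * (2 * Real.log d - 1))))) :
    -- each step of the algorithm is well defined
    (∀ w : GlobalCost.Pair d, ∃! x, GlobalCost.IsLeader (GlobalCost.lpNorm p) A q' w x) ∧
    (∀ x : GlobalCost.Pair d, ∃ a, GlobalCost.IsOracleAction x a) ∧
    -- the regret guarantee
    (∀ (x : ℕ → GlobalCost.Pair d) (a ℓ : ℕ → Fin d → ℝ),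
      (∀ t : ℕ, 1 ≤ t → ℓ t ∈ Set.Icc (0 : Fin d → ℝ) 1) →
      GlobalCost.IsFTRLPlay (GlobalCost.lpNorm p) A q' η x a ℓ →
      ∀ T : ℕ, 1 ≤ T →
        GlobalCost.avgRegret (GlobalCost.lpNorm p) a ℓ T ≤
          4 / Real.sqrt T *
            max ((d : ℝ) ^ ((p⁻¹).toReal - 1 / 2)) (Real.sqrt (2 * Real.exp 1 * Real.log d))) := by
  have : Fact (1 ≤ p) := ⟨hp.le⟩
  have : NeZero d := ⟨by omega⟩
  have hd0 : 0 < d := by omega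
  have hd' : (0 : ℝ) < d := by exact_mod_cast hd0
  have hApos : 0 < A := hA ▸ lt_min (Real.rpow_pos_of_pos hd' _) one_pos
  obtain ⟨hq1, hq2⟩ := hq'_mem
  refine ⟨GlobalCost.existsUnique_isLeader p hApos hq1 hq2,
    GlobalCost.exists_isOracleAction, fun x a ℓ hℓ hplay T hT => ?_⟩
  set m : ℝ := 2 * Real.log d - 1 with hm
  have hminv : (q' - 1)⁻¹ = m := by rw [hq', add_sub_cancel_left, inv_inv]
  have hm1 : 1 ≤ m := hminv ▸ (one_le_inv₀ (by linarith)).2 (by linarith)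
  set M := max ((d : ℝ) ^ (2 * (p⁻¹).toReal - 1)) (Real.exp 1 * m) with hM
  have hexp : 1 ≤ Real.exp 1 := Real.one_le_exp zero_le_one
  have hem : 1 ≤ Real.exp 1 * m := by nlinarith
  have hMpos : 0 < M := lt_max_of_lt_left (Real.rpow_pos_of_pos hd' _)
  have hAE : 1 / A + Real.exp 1 / (q' - 1) ≤ 2 * M := by
    rw [hA, GlobalCost.one_div_min_rpow hd0, div_eq_mul_inv, hminv]
    linarith [le_max_right ((d : ℝ) ^ (2 * (p⁻¹).toReal - 1)) (Real.exp 1 * m),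
      max_le_max (le_refl ((d : ℝ) ^ (2 * (p⁻¹).toReal - 1))) hem]
  have hT0 : (0 : ℝ) < T := by exact_mod_cast hT
  have hnonneg : (0 : Fin d → ℝ) ≤ (T : ℝ)⁻¹ • ∑ t ∈ Finset.Icc 1 T, ℓ t :=
    smul_nonneg (by positivity)
      (Finset.sum_nonneg fun t ht => (hℓ t (Finset.mem_Icc.1 ht).1).1)
  obtain ⟨u, hu, hreg⟩ := GlobalCost.exists_mem_decisionSet_le_pairing hp
    ((T : ℝ)⁻¹ • ∑ t ∈ Finset.Icc 1 T, a t * ℓ t) hnonneg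
  have hu1 : GlobalCost.regularizer A q' u ≤ 1 :=
    hA ▸ GlobalCost.regularizer_le_one hp.le hd0 hq1 hu
  have hsum := hplay.pairing_sum_le_sqrt hApos hq1 hq2
    (GlobalCost.sq_rpow_one_sub_inv_eq_exp hd hq' hq1).le hMpos hAE hη hℓ hT hu hu1
  have hpay : ((T : ℝ)⁻¹ • ∑ t ∈ Finset.Icc 1 T, a t * ℓ t, (T : ℝ)⁻¹ • ∑ t ∈ Finset.Icc 1 T, ℓ t)
      = (T : ℝ)⁻¹ • ∑ t ∈ Finset.Icc 1 T, GlobalCost.payoff (a t) (ℓ t) := by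
    simp only [GlobalCost.payoff]
    rw [Prod.ext_iff]
    simp [Prod.fst_sum, Prod.snd_sum]
  have hsqrtM : √M ≤ max ((d : ℝ) ^ ((p⁻¹).toReal - 1 / 2))
      (Real.sqrt (2 * Real.exp 1 * Real.log d)) := by
    rw [hM]
    rcases max_choice ((d : ℝ) ^ (2 * (p⁻¹).toReal - 1)) (Real.exp 1 * m) with h | h <;> rw [h]
    · refine le_trans (le_of_eq ?_) (le_max_left _ _)
      rw [Real.sqrt_eq_rpow, ← Real.rpow_mul hd'.le]
      congr 1
      ring
    · refine le_trans (Real.sqrt_le_sqrt ?_) (le_max_right _ _)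
      rw [hm]
      nlinarith
  rw [GlobalCost.avgRegret_eq]
  refine hreg.trans ?_
  rw [hpay, GlobalCost.pairing_smul_left]
  calc (T : ℝ)⁻¹ * GlobalCost.pairing (∑ t ∈ Finset.Icc 1 T, GlobalCost.payoff (a t) (ℓ t)) u
      ≤ (T : ℝ)⁻¹ * (4 * (√T * √M)) := by gcongr
    _ = 4 / √T * √M := by
        have : 0 < √(T : ℝ) := Real.sqrt_pos.2 hT0
        nth_rewrite 1 [← Real.mul_self_sqrt hT0.le]
        field_simp
    _ ≤ _ := by gcongr
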